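/- **Setting.** Let $\phi_1,\phi_2,\dots:[0,1]\to\mathbb R$ be functions with $\sup_j\|\phi_j\|_\infty<\infty$ (for example a bounded basis of $L_2[0,1]$), and for each $n$ let $x_1,\dots,x_n\in[0,1]$ be fixed design points (they may depend on $n$). For a sequence $\theta$ put $f_\theta=\sum_{i\ge1}\theta_i\phi_i$; a vector $\theta\in\Theta(k)=\mathbb R^k$ is identified with $(\theta_1,\dots,\theta_k,0,0,\dots)$. Under $P^{(n)}_{\theta_0}$ the data are $Y_i=f_{\theta_0}(x_i)+Z_i$, $i\le n$, with $Z_i$ i.i.d. $N(0,1)$. Let $$d_n(\theta,\theta')^2=\frac1n\sum_{i=1}^n\big(f_\theta(x_i)-f_{\theta'}(x_i)\big)^2,\qquad S^\beta(L_0)=\Big\{\theta:\sum_{i\ge1}\theta_i^2i^{2\beta}\le L_0\Big\},$$ $$b(k)=\inf_{\theta\in\mathbb R^k}d_n(\theta_0,\theta)^2,\quad \epsilon_n^2(k)=b(k)+\frac{k\log n}n,\quad k_n=\min\Big\{k\ge1:\ b(k)\le \frac{k\log n}n\Big\}$$ (these depend on $\theta_0$). Let $\beta_0>1/2$, $L_0>0$,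 $\alpha\in(0,1)$, $C_0>0$. Let $K_n$ be integers such that, for all large $n$, $K_n>n^{\beta_0/((1+2\beta_0)(\beta_0-1/2))}$ and $C_0^{-1}I_k\le \Phi_k^T\Phi_k/n\le C_0I_k$ for all $k\le K_n$, where $\Phi_k=(\phi_j(x_i))_{i\le n,\,j\le k}$. For integers $R_0\ge2$, $k_0\ge1$ and reals $\tau\in(0,1)$, $\delta<1\wedge C_0$ let $\Theta_{0,n}$ be the set of $\theta_0$ with $$b(kR_0)\le\tau\, b(k)\ \text{ for all } k_0\le k\le k_n\qquad\text{and}\qquad b(K_n)\le\delta K_n\log n/n .$$ **Prior and posterior.** Given $k$, the coordinates $\theta_1,\dots,\theta_k$ are i.i.d. with a probability density $g$ satisfying $G_1e^{-G_2|t|^q}\le g(t)\le G_3e^{-G_4|t|^q}$ for all $t$, for some $G_1,\dots,G_4>0$ and $q\ge1$. The posterior $\pi(\cdot\mid\mathbf Y)$ is one of the following. * Hierarchical: $k$ has a geometric law (parameter in $(0,1)$) on $\{1,2,\dots\}$, or a Poisson law (parameter $\lambda>0$) conditioned on $k\ge1$. * Empirical Bayes: $\pi_{|\hat k_n}(\cdot\mid\mathbf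 Y)$, the posterior given $k$ taken at $k=\hat k_n$, where $\hat k_n$ is a (measurable) maximizer of the marginal likelihood of $k$ over $1\le k\le\bar K_n$, and, for all large $n$, $\bar K_n\le K_n$ and $k_n\le\bar K_n$ for every $\theta_0\in S^{\beta_0}(L_0)$. Let $\hat\theta_n$ be an estimator with absolutely summable values, and let $$r_\alpha=\inf\{r:\ \pi(\theta:d_n(\theta,\hat\theta_n)\le r\mid\mathbf Y)\ge1-\alpha\},\qquad \hat C_n(L,\alpha)=\{\theta:\ d_n(\theta,\hat\theta_n)\le L\,r_\alpha\},$$ where $\theta$ ranges over the absolutely summable sequences. Say that $\hat\theta_n$ is rate-adaptive on sets $T_n$ if for every $\varepsilon>0$ there is $M_\varepsilon$ such that, for all large $n$, $\inf_{\theta_0\in T_n}P^{(n)}_{\theta_0}\big(d_n(\theta_0,\hat\theta_n)\le M_\varepsilon\,\epsilon_n(k_n)\big)\ge1-\varepsilon$. **Proposition.** For the hierarchical as well as the empirical Bayes posterior the following holds. 1. (Coverage.) If $\hat\theta_n$ is rate-adaptive on $\Theta_{0,n}\cap S^{\beta_0}(L_0)$, then for every $\varepsilon>0$ there is $L>0$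 such that $$\liminf_n\ \inf_{\theta_0\in\Theta_{0,n}\cap S^{\beta_0}(L_0)}P^{(n)}_{\theta_0}\big(\theta_0\in\hat C_n(L\sqrt{\log n},\alpha)\big)\ge1-\varepsilon .$$ 2. (Size.) If $\hat\theta_n$ is rate-adaptive on $S^{\beta_0}(L_0)$, then for every $\varepsilon>0$ there is $C>0$ such that $$\liminf_n\ \inf_{\beta\ge\beta_0}\ \inf_{\theta_0\in S^\beta(L_0)}P^{(n)}_{\theta_0}\Big(\operatorname{diam}\big(\hat C_n(1,\alpha),d_n\big)\le C\Big(\frac n{\log n}\Big)^{-\beta/(1+2\beta)}\Big)\ge1-\varepsilon ,$$ where $\operatorname{diam}(S,d_n)=\sup_{\theta,\theta'\in S}d_n(\theta,\theta')$. -/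

import Mathlib

open MeasureTheory ProbabilityTheory Filter
open scoped ENNReal NNReal

namespace SieveRegression

noncomputable section

/-! Sequences `θ : ℕ → ℝ` are indexed from zero: `θ j` is the coefficient `θ_{j+1}` of the basis
function `φ j`, which stands for `φ_{j+1}`. For a fixed sample size `n`, the design is a vector
`x : Fin n → ℝ` and the data is a vector `y : Fin n → ℝ`. -/

/-- The function `f_θ = ∑ θ_j φ_j`. -/
def regFun (φ : ℕ → ℝ → ℝ) (θ : ℕ → ℝ) (t : ℝ) : ℝ := ∑' j, θ j * φ j t

/-- The law of the data: independent `Y_i ~ N(f_θ(x_i), 1)`. -/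
def dataLaw (φ : ℕ → ℝ → ℝ) {n : ℕ} (x : Fin n → ℝ) (θ : ℕ → ℝ) : Measure (Fin n → ℝ) :=
  Measure.pi fun i => gaussianReal (regFun φ θ (x i)) 1

/-- The density of `dataLaw` with respect to Lebesgue measure, at the data `y`. -/
def likelihood (φ : ℕ → ℝ → ℝ) {n : ℕ} (x : Fin n → ℝ) (θ : ℕ → ℝ) (y : Fin n → ℝ) : ℝ≥0∞ :=
  ∏ i, gaussianPDF (regFun φ θ (x i)) 1 (y i)

/-- The empirical `L_2` semi-metric `d_n`. -/
def empDist (φ : ℕ → ℝ → ℝ) {n : ℕ} (x : Fin n → ℝ) (θ θ' : ℕ → ℝ) : ℝ :=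
  Real.sqrt ((1 / (n : ℝ)) * ∑ i, (regFun φ θ (x i) - regFun φ θ' (x i)) ^ 2)

/-- The inclusion of `Θ(k) = ℝ^k` into the sequences, by zeros. -/
def extend {k : ℕ} (θ : Fin k → ℝ) : ℕ → ℝ := fun j => if h : j < k then θ ⟨j, h⟩ else 0

/-- The Sobolev-type class `S^β(L₀)`: `∑_{i ≥ 1} θ_i² i^{2β} ≤ L₀`. -/
def sobolev (β L₀ : ℝ) : Set (ℕ → ℝ) :=
  {θ | Summable (fun j : ℕ => θ j ^ 2 * ((j : ℝ) + 1) ^ (2 * β)) ∧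
    ∑' j : ℕ, θ j ^ 2 * ((j : ℝ) + 1) ^ (2 * β) ≤ L₀}

/-- The `n × k` matrix `Φ_k` of the first `k` basis functions at the design points. -/
def designMatrix (φ : ℕ → ℝ → ℝ) {n : ℕ} (x : Fin n → ℝ) (k : ℕ) : Matrix (Fin n) (Fin k) ℝ :=
  Matrix.of fun i j => φ j (x i)

/-- `C₀⁻¹ I_k ≤ Φ_kᵀ Φ_k / n ≤ C₀ I_k` for all `k ≤ K`, in the Loewner order. -/
def GramCondition (φ : ℕ → ℝ → ℝ) {n : ℕ} (x : Fin n → ℝ) (C₀ : ℝ) (K : ℕ) : Prop :=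
  ∀ k ≤ K,
    (((1 / (n : ℝ)) • ((designMatrix φ x k).transpose * designMatrix φ x k)) -
      C₀⁻¹ • (1 : Matrix (Fin k) (Fin k) ℝ)).PosSemidef ∧
    (C₀ • (1 : Matrix (Fin k) (Fin k) ℝ) -
      ((1 / (n : ℝ)) • ((designMatrix φ x k).transpose * designMatrix φ x k))).PosSemidef

/-- The squared distance `b(k)` of the truth `θ₀` from `Θ(k)`. -/
def bias (φ : ℕ → ℝ → ℝ) {n : ℕ} (x : Fin n → ℝ) (θ₀ : ℕ → ℝ) (k : ℕ) : ℝ :=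
  ⨅ θ : Fin k → ℝ, empDist φ x θ₀ (extend θ) ^ 2

/-- `k_n = inf {k ≥ 1 : b(k) ≤ k log n / n}`. -/
def kOpt (φ : ℕ → ℝ → ℝ) {n : ℕ} (x : Fin n → ℝ) (θ₀ : ℕ → ℝ) : ℕ :=
  sInf {k : ℕ | 1 ≤ k ∧ bias φ x θ₀ k ≤ k * Real.log n / n}

/-- `ε_n(k) = (b(k) + k log n / n)^{1/2}`. -/
def epsRate (φ : ℕ → ℝ → ℝ) {n : ℕ} (x : Fin n → ℝ) (θ₀ : ℕ → ℝ) (k : ℕ) : ℝ :=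
  Real.sqrt (bias φ x θ₀ k + k * Real.log n / n)

/-- The class `Θ_{0,n}`: the general polished tail condition, together with
`b(K) ≤ δ K log n / n`. -/
def polishedTail (φ : ℕ → ℝ → ℝ) {n : ℕ} (x : Fin n → ℝ) (R₀ k₀ : ℕ) (τ δ : ℝ) (K : ℕ) :
    Set (ℕ → ℝ) :=
  {θ₀ | (∀ k, k₀ ≤ k → k ≤ kOpt φ x θ₀ → bias φ x θ₀ (k * R₀) ≤ τ * bias φ x θ₀ k) ∧
    bias φ x θ₀ K ≤ δ * (K * Real.log n / n)}

/-- A probability density `g` on `ℝ` with `G₁ exp(-G₂|t|^q) ≤ g(t) ≤ G₃ exp(-G₄|t|^q)` for some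
positive `G₁, G₂, G₃, G₄` and some `q ≥ 1`. -/
def IsCoefDensity (g : ℝ → ℝ) : Prop :=
  Measurable g ∧ (∫⁻ t, ENNReal.ofReal (g t)) = 1 ∧
  ∃ G₁ G₂ G₃ G₄ q : ℝ, 0 < G₁ ∧ 0 < G₂ ∧ 0 < G₃ ∧ 0 < G₄ ∧ 1 ≤ q ∧
    ∀ t, G₁ * Real.exp (-(G₂ * |t| ^ q)) ≤ g t ∧ g t ≤ G₃ * Real.exp (-(G₄ * |t| ^ q))

/-- The prior on `Θ(k) = ℝ^k`: independent coordinates with density `g`. -/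
def coefPrior (g : ℝ → ℝ) (k : ℕ) : Measure (Fin k → ℝ) :=
  Measure.pi fun _ => (volume : Measure ℝ).withDensity fun t => ENNReal.ofReal (g t)

/-- The prior on the dimension `k ≥ 1`: a geometric or a Poisson law on `ℕ`, conditioned on
`k ≥ 1` (for the geometric law this is the geometric law on `{1, 2, …}`). -/
def IsDimPrior (ρ : Measure ℕ) : Prop :=
  (∃ p : unitInterval, 0 < p ∧ p < 1 ∧ ρ = ProbabilityTheory.cond (geometricMeasure p) {k | 1 ≤ k}) ∨
  (∃ r : ℝ≥0, 0 < r ∧ ρ = ProbabilityTheory.cond (poissonMeasure r) {k | 1 ≤ k})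

/-- The integral of the likelihood over the part of `Θ(k)` in `B`, against the prior given `k`. For
`B = Set.univ` it is the marginal likelihood of `k`. -/
def evidence (φ : ℕ → ℝ → ℝ) (g : ℝ → ℝ) {n : ℕ} (x y : Fin n → ℝ) (k : ℕ) (B : Set (ℕ → ℝ)) :
    ℝ≥0∞ :=
  ∫⁻ θ in {θ : Fin k → ℝ | extend θ ∈ B}, likelihood φ x (extend θ) y ∂(coefPrior g k)

/-- The posterior probability of `B` for fixed `k`. -/
def condPosterior (φ : ℕ → ℝ → ℝ) (g : ℝ → ℝ) {n : ℕ} (x y : Fin n → ℝ) (k : ℕ)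
    (B : Set (ℕ → ℝ)) : ℝ≥0∞ :=
  evidence φ g x y k B / evidence φ g x y k Set.univ

/-- The posterior probability of `B` for the hierarchical prior with `k ~ ρ`. -/
def hierPosterior (φ : ℕ → ℝ → ℝ) (g : ℝ → ℝ) (ρ : Measure ℕ) {n : ℕ} (x y : Fin n → ℝ)
    (B : Set (ℕ → ℝ)) : ℝ≥0∞ :=
  (∑' k, ρ {k} * evidence φ g x y k B) / (∑' k, ρ {k} * evidence φ g x y k Set.univ)

/-- `k` maximizes the marginal likelihood over `{1, …, Kbar}`. -/
def IsMMLE (φ : ℕ → ℝ → ℝ) (g : ℝ → ℝ) {n : ℕ} (x y : Fin n → ℝ) (Kbar k : ℕ) : Prop :=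
  k ∈ Set.Icc 1 Kbar ∧
    ∀ k' ∈ Set.Icc 1 Kbar, evidence φ g x y k' Set.univ ≤ evidence φ g x y k Set.univ

/-- `post` is, for every sample size `n` and data `y`, the hierarchical posterior. -/
def IsHierarchical (φ : ℕ → ℝ → ℝ) (g : ℝ → ℝ) (x : ∀ n, Fin n → ℝ)
    (post : ∀ n, (Fin n → ℝ) → Set (ℕ → ℝ) → ℝ≥0∞) : Prop :=
  ∃ ρ : Measure ℕ, IsDimPrior ρ ∧ ∀ n y B, post n y B = hierPosterior φ g ρ (x n) y B

/-- `post` is the empirical Bayes posterior: the maximum marginal likelihood estimator of `k` over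
`{1, …, Kbar n}` is plugged in. The range of the maximization satisfies
`k_n(θ₀) ≤ Kbar n ≤ K n` for all `θ₀ ∈ S`, for all large `n`. -/
def IsEmpiricalBayes (φ : ℕ → ℝ → ℝ) (g : ℝ → ℝ) (x : ∀ n, Fin n → ℝ) (K : ℕ → ℕ)
    (S : Set (ℕ → ℝ)) (post : ∀ n, (Fin n → ℝ) → Set (ℕ → ℝ) → ℝ≥0∞) : Prop :=
  ∃ (Kbar : ℕ → ℕ) (khat : ∀ n, (Fin n → ℝ) → ℕ),
    (∀ᶠ n in atTop, Kbar n ≤ K n ∧ ∀ θ₀ ∈ S, kOpt φ (x n) θ₀ ≤ Kbar n) ∧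
    (∀ n, Measurable (khat n)) ∧
    (∀ᶠ n in atTop, ∀ y, IsMMLE φ g (x n) y (Kbar n) (khat n y)) ∧
    ∀ n y B, post n y B = condPosterior φ g (x n) y (khat n y) B

/-- The radius `r_α = inf {r : π(θ : d_n(θ, c) ≤ r | y) ≥ 1 - α}` of the credible ball with
centre `c`, for the posterior probability `post`. -/
def credRadius (φ : ℕ → ℝ → ℝ) {n : ℕ} (x : Fin n → ℝ) (post : Set (ℕ → ℝ) → ℝ≥0∞)
    (c : ℕ → ℝ) (α : ℝ) : ℝ :=
  sInf {r : ℝ | ENNReal.ofReal (1 - α) ≤ post {θ | empDist φ x θ c ≤ r}}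

/-- The credible ball `{θ : d_n(θ, c) ≤ L r_α}`, inflated by the factor `L`, in the space of
absolutely summable coefficient sequences. -/
def credBall (φ : ℕ → ℝ → ℝ) {n : ℕ} (x : Fin n → ℝ) (post : Set (ℕ → ℝ) → ℝ≥0∞)
    (c : ℕ → ℝ) (α L : ℝ) : Set (ℕ → ℝ) :=
  {θ | (Summable fun j => |θ j|) ∧ empDist φ x θ c ≤ L * credRadius φ x post c α}

/-- The `d_n`-diameter of a set. -/
def empDiam (φ : ℕ → ℝ → ℝ) {n : ℕ} (x : Fin n → ℝ) (S : Set (ℕ → ℝ)) : ℝ≥0∞ :=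
  ⨆ θ ∈ S, ⨆ θ' ∈ S, ENNReal.ofReal (empDist φ x θ θ')

/-- An estimator: measurable in the data, with absolutely summable values. -/
def IsEstimator (θhat : ∀ n, (Fin n → ℝ) → ℕ → ℝ) : Prop :=
  ∀ n, Measurable (θhat n) ∧ ∀ y, Summable fun j => |θhat n y j|

/-- The estimator attains the rate `ε_n(k_n)` uniformly over the classes `T n`: for all `ε > 0` there
is `M` with `P_{θ₀}(d_n(θ₀, θhat) ≤ M ε_n(k_n)) ≥ 1 - ε` for all `θ₀ ∈ T n`, for all large `n`. -/
def CenteringCondition (φ : ℕ → ℝ → ℝ) (x : ∀ n, Fin n → ℝ) (T : ℕ → Set (ℕ → ℝ))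
    (θhat : ∀ n, (Fin n → ℝ) → ℕ → ℝ) : Prop :=
  ∀ ε : ℝ, 0 < ε → ∃ M : ℝ, 0 < M ∧ ∀ᶠ n in atTop, ∀ θ₀ ∈ T n,
    1 - ENNReal.ofReal ε ≤ dataLaw φ (x n) θ₀
      {y | empDist φ (x n) θ₀ (θhat n y) ≤ M * epsRate φ (x n) θ₀ (kOpt φ (x n) θ₀)}

end

end SieveRegression

namespace SieveRegression

noncomputable section

/-! ### Product integrals -/

/-! Write `κ` for the oracle dimension `kOpt`. Both claims reduce to squeezing the credible radius:
with large probability, uniformly in the truth, it is at most of order `√(κ log n / n)`, and under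
the polished tail condition it is at least of order `√(κ / n)`. A rate-adaptive centre lies within a
multiple of `√(κ log n / n)` of the truth, so inflating the radius by a multiple of `√(log n)`
covers the truth. The size claim follows from the upper bound, because `κ ≲ (n / log n)^{1/(1+2β)}`
on the Sobolev classes (`exists_kOpt_le`).

The probabilistic input is one event, `TypicalData`. The projection of the noise onto the span of a
sieve and the truth has squared length at most `k log n / 8` simultaneously for all `k ≤ K`, by a
chi-square bound and a union over `k`. On this event the remaining estimates are deterministic. The
likelihood ratio at distance `h` in Euclidean norm is at most `exp(noiseSq - h²/4)`, and
Laplace-type bounds show that the evidence of dimension `k` is the maximal likelihood times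
`(c/√n)^k`, up to the value of `c`. Keeping only `k = κ`, the denominator of the posterior is at
least `exp(-C κ log n)` times the true likelihood.

Upper bound (`exists_hierPosterior_far_le`): dimensions far above `κ` are suppressed by the factor
`n^{-k/4}`, and for the others parameters far from the truth have small likelihood.

Lower bound (`exists_hierPosterior_ball_le`): the polished tail makes the bias of any `k` much
smaller than `κ` so large that these dimensions get negligible mass. For `k` of order at least `κ`,
a ball of radius `r` about any centre, even one depending on the data, has conditional posterior
mass at most `(C r √(n/k))^k`, which is small at `r = c √(κ/n)`.

Empirical Bayes is treated as a hierarchical posterior whose prior on the dimension is a point mass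
at the maximizer. The maximizing property gives the same lower bound on the denominator. For a
genuine prior on the dimension, the part `k > K` is controlled in expectation by an exponential
moment (`dataLaw_tail_gt_le`). -/

theorem lintegral_pi_prod {n : ℕ} (μ : Fin n → Measure ℝ) [∀ i, SigmaFinite (μ i)]
    (f : Fin n → ℝ → ℝ≥0∞) (hf : ∀ i, Measurable (f i)) :
    ∫⁻ z, ∏ i, f i (z i) ∂(Measure.pi μ) = ∏ i, ∫⁻ t, f i t ∂(μ i) := by
  induction n with
  | zero => simp
  | succ n ih =>
    have hmp := (measurePreserving_piFinSuccAbove μ 0).symm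
    rw [← hmp.lintegral_comp_emb (MeasurableEquiv.measurableEmbedding _)]
    simp only [Fin.prod_univ_succ]
    have := ih (fun i => μ (Fin.succAbove 0 i)) (fun i => f i.succ) (fun i => hf _)
    simp only [Fin.zero_succAbove] at this ⊢
    rw [← this]
    have hm : Measurable fun z : Fin n → ℝ => ∏ i, f i.succ (z i) :=
      Finset.measurable_fun_prod _ fun i _ => (hf _).comp (measurable_pi_apply i)
    rw [← lintegral_prod_mul (hf 0).aemeasurable hm.aemeasurable]
    rfl

theorem pi_withDensity {n : ℕ} (f : Fin n → ℝ → ℝ≥0∞) (hf : ∀ i, Measurable (f i))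
    [∀ i, SigmaFinite ((volume : Measure ℝ).withDensity (f i))] :
    Measure.pi (fun i => (volume : Measure ℝ).withDensity (f i)) =
      (volume : Measure (Fin n → ℝ)).withDensity fun z => ∏ i, f i (z i) := by
  refine Measure.pi_eq fun s hs => ?_
  rw [withDensity_apply _ (MeasurableSet.univ_pi hs), volume_pi, Measure.restrict_pi_pi,
    lintegral_pi_prod _ _ hf]
  exact Finset.prod_congr rfl fun i _ => (withDensity_apply _ (hs i)).symm

theorem coefPrior_eq_withDensity {g : ℝ → ℝ} (hg : IsCoefDensity g) (k : ℕ) :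
    coefPrior g k = (volume : Measure (Fin k → ℝ)).withDensity
      fun θ => ∏ j, ENNReal.ofReal (g (θ j)) := by
  have : IsProbabilityMeasure
      ((volume : Measure ℝ).withDensity fun t => ENNReal.ofReal (g t)) :=
    ⟨by simpa using hg.2.1⟩
  exact pi_withDensity _ fun _ => hg.1.ennreal_ofReal

theorem isProbabilityMeasure_coefPrior {g : ℝ → ℝ} (hg : IsCoefDensity g) (k : ℕ) :
    IsProbabilityMeasure (coefPrior g k) := by
  have : IsProbabilityMeasure
      ((volume : Measure ℝ).withDensity fun t => ENNReal.ofReal (g t)) :=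
    ⟨by simpa using hg.2.1⟩
  unfold coefPrior
  infer_instance

/-! ### The fitted vectors -/

/-- The vector `(f_θ(x_i))_i` in Euclidean space. -/
def fitVec (φ : ℕ → ℝ → ℝ) {n : ℕ} (x : Fin n → ℝ) (θ : ℕ → ℝ) : EuclideanSpace ℝ (Fin n) :=
  WithLp.toLp 2 fun i => regFun φ θ (x i)

theorem regFun_extend (φ : ℕ → ℝ → ℝ) {k : ℕ} (θ : Fin k → ℝ) (t : ℝ) :
    regFun φ (extend θ) t = ∑ j : Fin k, θ j * φ j t := by
  unfold regFun
  rw [tsum_eq_sum (s := Finset.range k)]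
  · rw [Finset.sum_range]
    exact Finset.sum_congr rfl fun j _ => by simp [extend]
  · intro j hj
    have : ¬ j < k := by simpa using hj
    simp [extend, this]

/-- The fitted vector of a finite sequence, as a linear map. -/
def fitLin (φ : ℕ → ℝ → ℝ) {n : ℕ} (x : Fin n → ℝ) (k : ℕ) :
    (Fin k → ℝ) →ₗ[ℝ] EuclideanSpace ℝ (Fin n) where
  toFun θ := fitVec φ x (extend θ)
  map_add' a b := by
    ext i
    simp [fitVec, regFun_extend, add_mul, Finset.sum_add_distrib]
  map_smul' c a := by
    ext i
    simp [fitVec, regFun_extend, Finset.mul_sum, mul_assoc]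

theorem fitLin_apply (φ : ℕ → ℝ → ℝ) {n : ℕ} (x : Fin n → ℝ) (k : ℕ) (θ : Fin k → ℝ) :
    fitLin φ x k θ = fitVec φ x (extend θ) := rfl

theorem empDist_sq (φ : ℕ → ℝ → ℝ) {n : ℕ} (x : Fin n → ℝ) (θ θ' : ℕ → ℝ) :
    empDist φ x θ θ' ^ 2 = ‖fitVec φ x θ - fitVec φ x θ'‖ ^ 2 / n := by
  unfold empDist
  rw [Real.sq_sqrt (by positivity), EuclideanSpace.norm_sq_eq]
  simp [fitVec, div_eq_inv_mul]

theorem empDist_nonneg (φ : ℕ → ℝ → ℝ) {n : ℕ} (x : Fin n → ℝ) (θ θ' : ℕ → ℝ) :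
    0 ≤ empDist φ x θ θ' := Real.sqrt_nonneg _

theorem empDist_eq (φ : ℕ → ℝ → ℝ) {n : ℕ} (x : Fin n → ℝ) (θ θ' : ℕ → ℝ) :
    empDist φ x θ θ' = ‖fitVec φ x θ - fitVec φ x θ'‖ / Real.sqrt n := by
  rw [← Real.sqrt_sq (empDist_nonneg φ x θ θ'), empDist_sq, Real.sqrt_div' _ (by positivity),
    Real.sqrt_sq (norm_nonneg _)]

theorem empDist_triangle (φ : ℕ → ℝ → ℝ) {n : ℕ} (x : Fin n → ℝ) (θ θ' θ'' : ℕ → ℝ) :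
    empDist φ x θ θ'' ≤ empDist φ x θ θ' + empDist φ x θ' θ'' := by
  simp only [empDist_eq, ← add_div]
  gcongr
  exact norm_sub_le_norm_sub_add_norm_sub _ _ _

theorem empDist_comm (φ : ℕ → ℝ → ℝ) {n : ℕ} (x : Fin n → ℝ) (θ θ' : ℕ → ℝ) :
    empDist φ x θ θ' = empDist φ x θ' θ := by
  simp only [empDist_eq, norm_sub_rev]

theorem likelihood_eq (φ : ℕ → ℝ → ℝ) {n : ℕ} (x : Fin n → ℝ) (θ : ℕ → ℝ) (y : Fin n → ℝ) :
    likelihood φ x θ y = ENNReal.ofReal ((Real.sqrt (2 * Real.pi))⁻¹ ^ n *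
      Real.exp (-(‖WithLp.toLp 2 y - fitVec φ x θ‖ ^ 2 / 2))) := by
  unfold likelihood gaussianPDF
  rw [← ENNReal.ofReal_prod_of_nonneg fun i _ => gaussianPDFReal_nonneg _ _ _]
  congr 1
  simp only [gaussianPDFReal, NNReal.coe_one, mul_one, Finset.prod_mul_distrib, Finset.prod_const,
    Finset.card_univ, Fintype.card_fin, ← Real.exp_sum, EuclideanSpace.norm_sq_eq,
    ← Finset.sum_div, Finset.sum_neg_distrib, neg_div]
  simp [fitVec]

theorem likelihood_pos (φ : ℕ → ℝ → ℝ) {n : ℕ} (x : Fin n → ℝ) (θ : ℕ → ℝ) (y : Fin n → ℝ) :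
    0 < likelihood φ x θ y := by
  rw [likelihood_eq]
  simp only [ENNReal.ofReal_pos]
  positivity

theorem likelihood_le_one (φ : ℕ → ℝ → ℝ) {n : ℕ} (x : Fin n → ℝ) (θ : ℕ → ℝ) (y : Fin n → ℝ) :
    likelihood φ x θ y ≤ 1 := by
  rw [likelihood_eq, ENNReal.ofReal_le_one]
  refine mul_le_one₀ (pow_le_one₀ (by positivity) (inv_le_one_of_one_le₀ ?_)) (by positivity) ?_
  · rw [Real.one_le_sqrt]
    nlinarith [Real.pi_gt_three]
  · rw [Real.exp_le_one_iff]
    have := sq_nonneg ‖WithLp.toLp 2 y - fitVec φ x θ‖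
    linarith

theorem likelihood_ne_top (φ : ℕ → ℝ → ℝ) {n : ℕ} (x : Fin n → ℝ) (θ : ℕ → ℝ) (y : Fin n → ℝ) :
    likelihood φ x θ y ≠ ∞ := ne_top_of_le_ne_top ENNReal.one_ne_top (likelihood_le_one φ x θ y)

/-- Likelihoods differ by the exponential of half the difference of the residual sums of squares. -/
theorem likelihood_eq_mul_exp (φ : ℕ → ℝ → ℝ) {n : ℕ} (x : Fin n → ℝ) (θ θ' : ℕ → ℝ)
    (y : Fin n → ℝ) :
    likelihood φ x θ y = likelihood φ x θ' y * ENNReal.ofReal (Real.exp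
      ((‖WithLp.toLp 2 y - fitVec φ x θ'‖ ^ 2 - ‖WithLp.toLp 2 y - fitVec φ x θ‖ ^ 2) / 2)) := by
  rw [likelihood_eq, likelihood_eq, ← ENNReal.ofReal_mul (by positivity), mul_assoc, ← Real.exp_add]
  congr 3
  ring

/-- The quadratic form of `Φᵀ Φ` at `θ` is the squared length of the fitted vector, so the Loewner
bounds translate coefficient norms into `d_n` distances and back. -/
theorem gram_bounds {φ : ℕ → ℝ → ℝ} {n : ℕ} (hn : 0 < n) {x : Fin n → ℝ} {C₀ : ℝ} {K : ℕ}
    (h : GramCondition φ x C₀ K) {k : ℕ} (hk : k ≤ K) (θ : Fin k → ℝ) :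
    C₀⁻¹ * n * ∑ j, θ j ^ 2 ≤ ‖fitLin φ x k θ‖ ^ 2 ∧
      ‖fitLin φ x k θ‖ ^ 2 ≤ C₀ * n * ∑ j, θ j ^ 2 := by
  obtain ⟨h1, h2⟩ := h k hk
  have hn' : (0 : ℝ) < n := by exact_mod_cast hn
  have e1 := h1.dotProduct_mulVec_nonneg θ
  have e2 := h2.dotProduct_mulVec_nonneg θ
  have key : θ ⬝ᵥ (((designMatrix φ x k).transpose * designMatrix φ x k).mulVec θ)
      = ‖fitLin φ x k θ‖ ^ 2 := by
    rw [← Matrix.mulVec_mulVec, Matrix.dotProduct_mulVec, Matrix.vecMul_transpose,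
      EuclideanSpace.norm_sq_eq]
    simp only [dotProduct, fitLin_apply, fitVec, regFun_extend, Matrix.mulVec, designMatrix,
      Matrix.of_apply, Real.norm_eq_abs, sq_abs]
    refine Finset.sum_congr rfl fun i _ => ?_
    rw [sq]
    simp [mul_comm]
  have hs : θ ⬝ᵥ θ = ∑ j, θ j ^ 2 := by simp [dotProduct, sq]
  simp only [star_trivial, Matrix.sub_mulVec, Matrix.smul_mulVec, Matrix.one_mulVec,
    dotProduct_sub, dotProduct_smul, key, hs, smul_eq_mul] at e1 e2
  constructor
  · have := mul_le_mul_of_nonneg_left (sub_nonneg.1 e1) hn'.le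
    field_simp at this ⊢
    linarith
  · have := mul_le_mul_of_nonneg_left (sub_nonneg.1 e2) hn'.le
    field_simp at this ⊢
    linarith

/-! ### Exponential moments of the noise -/

/-- The noise vector `y - f_{θ₀}(x)`. -/
def noise (φ : ℕ → ℝ → ℝ) {n : ℕ} (x : Fin n → ℝ) (θ₀ : ℕ → ℝ) (y : Fin n → ℝ) :
    EuclideanSpace ℝ (Fin n) := WithLp.toLp 2 y - fitVec φ x θ₀

theorem measurable_noise (φ : ℕ → ℝ → ℝ) {n : ℕ} (x : Fin n → ℝ) (θ₀ : ℕ → ℝ) :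
    Measurable (noise φ x θ₀) := by
  unfold noise
  fun_prop

instance (φ : ℕ → ℝ → ℝ) {n : ℕ} (x : Fin n → ℝ) (θ₀ : ℕ → ℝ) :
    IsProbabilityMeasure (dataLaw φ x θ₀) := by
  unfold dataLaw
  infer_instance

theorem lintegral_exp_mul_gaussianReal (μ u : ℝ) :
    ∫⁻ t, ENNReal.ofReal (Real.exp (u * (t - μ))) ∂(gaussianReal μ 1) =
      ENNReal.ofReal (Real.exp (u ^ 2 / 2)) := by
  have h : (fun t => Real.exp (u * (t - μ))) =
      fun t => Real.exp (-(u * μ)) * Real.exp (u * t) := by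
    ext t
    rw [← Real.exp_add]
    ring_nf
  rw [← ofReal_integral_eq_lintegral_ofReal
    (by rw [h]; exact (integrable_exp_mul_gaussianReal u).const_mul _)
    (Eventually.of_forall fun t => (Real.exp_pos _).le), h, integral_const_mul]
  have := congrFun (mgf_id_gaussianReal (μ := μ) (v := 1)) u
  simp only [mgf, id] at this
  rw [this, ← Real.exp_add]
  congr 2
  simp
  ring

theorem lintegral_exp_sq_gaussianReal :
    ∫⁻ t, ENNReal.ofReal (Real.exp (t ^ 2 / 4)) ∂(gaussianReal 0 1) =
      ENNReal.ofReal (Real.sqrt 2) := by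
  rw [gaussianReal_of_var_ne_zero 0 one_ne_zero,
    lintegral_withDensity_eq_lintegral_mul _ (measurable_gaussianPDF 0 1) (by fun_prop)]
  have h : ∀ t : ℝ, (gaussianPDF 0 1 * fun t => ENNReal.ofReal (Real.exp (t ^ 2 / 4))) t =
      ENNReal.ofReal ((Real.sqrt (2 * Real.pi))⁻¹ * Real.exp (-(1 / 4) * t ^ 2)) := by
    intro t
    simp only [Pi.mul_apply, gaussianPDF, gaussianPDFReal]
    rw [← ENNReal.ofReal_mul (by positivity), mul_assoc, ← Real.exp_add]
    congr 2
    · simp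
    · congr 1
      simp
      ring
  simp only [h]
  rw [← ofReal_integral_eq_lintegral_ofReal
    ((integrable_exp_neg_mul_sq (by norm_num : (0 : ℝ) < 1 / 4)).const_mul _)
    (Eventually.of_forall fun t => by positivity), integral_const_mul, integral_gaussian,
    ← Real.sqrt_inv, ← Real.sqrt_mul (by positivity)]
  congr 2
  field_simp
  norm_num

theorem lintegral_exp_inner_noise (φ : ℕ → ℝ → ℝ) {n : ℕ} (x : Fin n → ℝ) (θ₀ : ℕ → ℝ)
    (u : EuclideanSpace ℝ (Fin n)) :
    ∫⁻ y, ENNReal.ofReal (Real.exp (inner ℝ u (noise φ x θ₀ y))) ∂(dataLaw φ x θ₀) =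
      ENNReal.ofReal (Real.exp (‖u‖ ^ 2 / 2)) := by
  have h : ∀ y, ENNReal.ofReal (Real.exp (inner ℝ u (noise φ x θ₀ y))) =
      ∏ i, ENNReal.ofReal (Real.exp (u i * (y i - regFun φ θ₀ (x i)))) := by
    intro y
    rw [← ENNReal.ofReal_prod_of_nonneg fun i _ => (Real.exp_pos _).le, ← Real.exp_sum]
    simp [PiLp.inner_apply, noise, fitVec, mul_comm]
  simp only [h]
  unfold dataLaw
  rw [lintegral_pi_prod _ (fun i t => ENNReal.ofReal (Real.exp (u i * (t - regFun φ θ₀ (x i)))))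
    (fun i => by fun_prop)]
  simp only [lintegral_exp_mul_gaussianReal]
  rw [← ENNReal.ofReal_prod_of_nonneg fun i _ => (Real.exp_pos _).le, ← Real.exp_sum,
    EuclideanSpace.norm_sq_eq, Finset.sum_div]
  simp

theorem norm_sq_starProjection {n : ℕ} (V : Submodule ℝ (EuclideanSpace ℝ (Fin n)))
    (z : EuclideanSpace ℝ (Fin n)) :
    ‖V.starProjection z‖ ^ 2 = ∑ i, (inner ℝ (stdOrthonormalBasis ℝ V i : EuclideanSpace ℝ (Fin n)) z) ^ 2 := by
  have h := (stdOrthonormalBasis ℝ V).sum_sq_norm_inner_right (V.orthogonalProjectionOnto z)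
  rw [Submodule.starProjection_apply, ← Submodule.coe_norm, ← h]
  refine Finset.sum_congr rfl fun i _ => ?_
  rw [Real.norm_eq_abs, sq_abs, Submodule.inner_orthogonalProjectionOnto_eq_of_mem_left]

/-- The exponential moment of the squared length of a projection of the noise. -/
theorem lintegral_exp_norm_sq_starProjection (φ : ℕ → ℝ → ℝ) {n : ℕ} (x : Fin n → ℝ) (θ₀ : ℕ → ℝ)
    (V : Submodule ℝ (EuclideanSpace ℝ (Fin n))) :
    ∫⁻ y, ENNReal.ofReal (Real.exp (‖V.starProjection (noise φ x θ₀ y)‖ ^ 2 / 4))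
      ∂(dataLaw φ x θ₀) = ENNReal.ofReal (Real.sqrt 2) ^ Module.finrank ℝ V := by
  set b := stdOrthonormalBasis ℝ V
  set γ : Measure (Fin (Module.finrank ℝ V) → ℝ) := Measure.pi fun _ => gaussianReal 0 1
  have hs2 : (Real.sqrt 2) ^ 2 = 2 := Real.sq_sqrt (by norm_num)
  -- Linearization: if `s` is standard Gaussian, averaging `exp ⟨w s, z⟩` over `s` gives `exp(‖P
  -- z‖²/4)`. Fubini then reduces the quadratic moment to the linear one already computed.
  let w : (Fin (Module.finrank ℝ V) → ℝ) → EuclideanSpace ℝ (Fin n) :=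
    fun s => ∑ i, (s i / Real.sqrt 2) • (b i : EuclideanSpace ℝ (Fin n))
  have hw : ∀ s, ‖w s‖ ^ 2 = ∑ i, s i ^ 2 / 2 := by
    intro s
    have : w s = ((∑ i, (s i / Real.sqrt 2) • b i : V) : EuclideanSpace ℝ (Fin n)) := by simp [w]
    rw [this, ← Submodule.coe_norm, ← b.sum_sq_norm_inner_right]
    refine Finset.sum_congr rfl fun i _ => ?_
    rw [b.orthonormal.inner_right_fintype, Real.norm_eq_abs, sq_abs, div_pow, hs2]
  have h1 : ∀ z : EuclideanSpace ℝ (Fin n),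
      ENNReal.ofReal (Real.exp (‖V.starProjection z‖ ^ 2 / 4)) =
        ∫⁻ s, ENNReal.ofReal (Real.exp (inner ℝ (w s) z)) ∂γ := by
    intro z
    have : ∀ s, ENNReal.ofReal (Real.exp (inner ℝ (w s) z)) = ∏ i, ENNReal.ofReal
        (Real.exp (inner ℝ (b i : EuclideanSpace ℝ (Fin n)) z / Real.sqrt 2 * (s i - 0))) := by
      intro s
      rw [← ENNReal.ofReal_prod_of_nonneg fun i _ => (Real.exp_pos _).le, ← Real.exp_sum,
        sum_inner]
      congr 2
      refine Finset.sum_congr rfl fun i _ => ?_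
      rw [real_inner_smul_left]
      ring
    simp only [this]
    rw [lintegral_pi_prod _ (fun i t => ENNReal.ofReal
      (Real.exp (inner ℝ (b i : EuclideanSpace ℝ (Fin n)) z / Real.sqrt 2 * (t - 0))))
      (fun i => by fun_prop)]
    simp only [lintegral_exp_mul_gaussianReal]
    rw [← ENNReal.ofReal_prod_of_nonneg fun i _ => (Real.exp_pos _).le, ← Real.exp_sum,
      norm_sq_starProjection, Finset.sum_div]
    congr 2
    refine Finset.sum_congr rfl fun i _ => ?_
    rw [div_pow, hs2]
    ring
  simp only [h1]
  rw [lintegral_lintegral_swap]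
  · simp only [lintegral_exp_inner_noise, hw]
    have : ∀ s : Fin (Module.finrank ℝ V) → ℝ,
        ENNReal.ofReal (Real.exp ((∑ i, s i ^ 2 / 2) / 2)) =
          ∏ i, ENNReal.ofReal (Real.exp (s i ^ 2 / 4)) := by
      intro s
      rw [← ENNReal.ofReal_prod_of_nonneg fun i _ => (Real.exp_pos _).le, ← Real.exp_sum,
        Finset.sum_div]
      congr 2
      exact Finset.sum_congr rfl fun i _ => by ring
    simp only [this]
    rw [lintegral_pi_prod _ (fun i t => ENNReal.ofReal (Real.exp (t ^ 2 / 4)))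
      (fun i => by fun_prop)]
    simp [lintegral_exp_sq_gaussianReal]
  · have := measurable_noise φ x θ₀
    refine Measurable.aemeasurable ?_
    simp only [w]
    fun_prop

/-- Chernoff's bound from the exponential moment at `1/4`. An upper bound `d` for the rank is enough
since `√2 ≥ 1`. -/
theorem dataLaw_norm_sq_starProjection_gt (φ : ℕ → ℝ → ℝ) {n : ℕ} (x : Fin n → ℝ) (θ₀ : ℕ → ℝ)
    (V : Submodule ℝ (EuclideanSpace ℝ (Fin n))) (t : ℝ) {d : ℕ} (hd : Module.finrank ℝ V ≤ d) :
    dataLaw φ x θ₀ {y | t < ‖V.starProjection (noise φ x θ₀ y)‖ ^ 2} ≤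
      ENNReal.ofReal (Real.exp (-(t / 4)) * Real.sqrt 2 ^ d) := by
  have hm := measurable_noise φ x θ₀
  have h := meas_ge_le_lintegral_div (μ := dataLaw φ x θ₀)
    (f := fun y => ENNReal.ofReal (Real.exp (‖V.starProjection (noise φ x θ₀ y)‖ ^ 2 / 4)))
    (by fun_prop) (ε := ENNReal.ofReal (Real.exp (t / 4)))
    (by simp [Real.exp_pos]) ENNReal.ofReal_ne_top
  rw [lintegral_exp_norm_sq_starProjection] at h
  refine (measure_mono fun y hy => ?_).trans (h.trans ?_)
  · simp only [Set.mem_ofPred_eq] at hy ⊢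
    exact ENNReal.ofReal_le_ofReal (Real.exp_le_exp.2 (by linarith))
  · rw [Real.exp_neg, ← ENNReal.ofReal_pow (by positivity),
      ← ENNReal.ofReal_div_of_pos (Real.exp_pos _), div_eq_inv_mul]
    refine ENNReal.ofReal_le_ofReal ?_
    gcongr
    rw [Real.one_le_sqrt]
    norm_num

/-! ### Likelihood ratios -/

theorem norm_sub_fitVec_sq (φ : ℕ → ℝ → ℝ) {n : ℕ} (x : Fin n → ℝ) (θ₀ θ : ℕ → ℝ)
    (y : Fin n → ℝ) :
    ‖WithLp.toLp 2 y - fitVec φ x θ‖ ^ 2 = ‖WithLp.toLp 2 y - fitVec φ x θ₀‖ ^ 2 -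
      2 * inner ℝ (fitVec φ x θ - fitVec φ x θ₀) (noise φ x θ₀ y) +
      ‖fitVec φ x θ - fitVec φ x θ₀‖ ^ 2 := by
  have : WithLp.toLp 2 y - fitVec φ x θ =
      noise φ x θ₀ y - (fitVec φ x θ - fitVec φ x θ₀) := by
    unfold noise
    abel
  rw [this, norm_sub_sq_real, real_inner_comm]
  rfl

theorem likelihood_eq_mul_exp_inner (φ : ℕ → ℝ → ℝ) {n : ℕ} (x : Fin n → ℝ) (θ₀ θ : ℕ → ℝ)
    (y : Fin n → ℝ) :
    likelihood φ x θ y = likelihood φ x θ₀ y * ENNReal.ofReal (Real.exp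
      (inner ℝ (fitVec φ x θ - fitVec φ x θ₀) (noise φ x θ₀ y) -
        ‖fitVec φ x θ - fitVec φ x θ₀‖ ^ 2 / 2)) := by
  rw [likelihood_eq_mul_exp φ x θ θ₀, norm_sub_fitVec_sq φ x θ₀ θ]
  congr 3
  ring

/-- The span of the sieve of dimension `k` and the true signal. -/
def sieveSpan (φ : ℕ → ℝ → ℝ) {n : ℕ} (x : Fin n → ℝ) (θ₀ : ℕ → ℝ) (k : ℕ) :
    Submodule ℝ (EuclideanSpace ℝ (Fin n)) :=
  (fitLin φ x k).range ⊔ Submodule.span ℝ {fitVec φ x θ₀}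

theorem finrank_sieveSpan_le (φ : ℕ → ℝ → ℝ) {n : ℕ} (x : Fin n → ℝ) (θ₀ : ℕ → ℝ) (k : ℕ) :
    Module.finrank ℝ (sieveSpan φ x θ₀ k) ≤ k + 1 := by
  refine (Submodule.finrank_add_le_finrank_add_finrank _ _).trans (add_le_add ?_ ?_)
  · simpa using (fitLin φ x k).finrank_range_le
  · simpa using finrank_span_le_card ({fitVec φ x θ₀} : Set (EuclideanSpace ℝ (Fin n)))

/-- The squared length of the projection of the noise on `sieveSpan`. -/
def noiseSq (φ : ℕ → ℝ → ℝ) {n : ℕ} (x : Fin n → ℝ) (θ₀ : ℕ → ℝ) (k : ℕ) (y : Fin n → ℝ) : ℝ :=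
  ‖(sieveSpan φ x θ₀ k).starProjection (noise φ x θ₀ y)‖ ^ 2

/-- The truth was added to the span so that the difference of fits lies in it. The inner product
then sees only the projected noise, and Cauchy–Schwarz gives a bound uniform in `θ`. -/
theorem abs_inner_noise_le (φ : ℕ → ℝ → ℝ) {n : ℕ} (x : Fin n → ℝ) (θ₀ : ℕ → ℝ) {k : ℕ}
    (y : Fin n → ℝ) (θ : Fin k → ℝ) :
    |inner ℝ (fitVec φ x (extend θ) - fitVec φ x θ₀) (noise φ x θ₀ y)| ≤
      ‖fitVec φ x (extend θ) - fitVec φ x θ₀‖ * Real.sqrt (noiseSq φ x θ₀ k y) := by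
  set V := sieveSpan φ x θ₀ k
  set h := fitVec φ x (extend θ) - fitVec φ x θ₀
  have hmem : h ∈ V := by
    refine V.sub_mem (Submodule.mem_sup_left ⟨θ, rfl⟩) (Submodule.mem_sup_right ?_)
    exact Submodule.mem_span_singleton_self _
  have : V.starProjection h = h := Submodule.starProjection_eq_self_iff.2 hmem
  rw [← this, Submodule.inner_starProjection_left_eq_right, this, noiseSq,
    Real.sqrt_sq (norm_nonneg _)]
  exact abs_real_inner_le_norm _ _

/-- By `ab ≤ a²/4 + b²`, half of the quadratic penalty absorbs the noise term; a quarter of the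
squared distance survives and the noise cost no longer depends on `θ`. -/
theorem likelihood_extend_le (φ : ℕ → ℝ → ℝ) {n : ℕ} (x : Fin n → ℝ) (θ₀ : ℕ → ℝ) {k : ℕ}
    (y : Fin n → ℝ) (θ : Fin k → ℝ) :
    likelihood φ x (extend θ) y ≤ likelihood φ x θ₀ y * ENNReal.ofReal (Real.exp
      (noiseSq φ x θ₀ k y - ‖fitVec φ x (extend θ) - fitVec φ x θ₀‖ ^ 2 / 4)) := by
  rw [likelihood_eq_mul_exp_inner φ x θ₀]
  refine mul_le_mul_right (ENNReal.ofReal_le_ofReal (Real.exp_le_exp.2 ?_)) _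
  have h1 := (abs_le.1 (abs_inner_noise_le φ x θ₀ y θ)).2
  have h2 : Real.sqrt (noiseSq φ x θ₀ k y) ^ 2 = noiseSq φ x θ₀ k y :=
    Real.sq_sqrt (sq_nonneg _)
  nlinarith [sq_nonneg (‖fitVec φ x (extend θ) - fitVec φ x θ₀‖ / 2 -
    Real.sqrt (noiseSq φ x θ₀ k y))]

theorem le_likelihood_extend (φ : ℕ → ℝ → ℝ) {n : ℕ} (x : Fin n → ℝ) (θ₀ : ℕ → ℝ) {k : ℕ}
    (y : Fin n → ℝ) (θ : Fin k → ℝ) :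
    likelihood φ x θ₀ y * ENNReal.ofReal (Real.exp
      (-(noiseSq φ x θ₀ k y / 2 + ‖fitVec φ x (extend θ) - fitVec φ x θ₀‖ ^ 2))) ≤
        likelihood φ x (extend θ) y := by
  rw [likelihood_eq_mul_exp_inner φ x θ₀ (extend θ)]
  gcongr
  have h1 := (abs_le.1 (abs_inner_noise_le φ x θ₀ y θ)).1
  have h2 : Real.sqrt (noiseSq φ x θ₀ k y) ^ 2 = noiseSq φ x θ₀ k y :=
    Real.sq_sqrt (sq_nonneg _)
  nlinarith [sq_nonneg (‖fitVec φ x (extend θ) - fitVec φ x θ₀‖ -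
    Real.sqrt (noiseSq φ x θ₀ k y))]

theorem measurable_fitLin (φ : ℕ → ℝ → ℝ) {n : ℕ} (x : Fin n → ℝ) (k : ℕ) :
    Measurable (fitLin φ x k) :=
  (LinearMap.continuous_of_finiteDimensional (fitLin φ x k)).measurable

/-- Tails of the weighted evidence relative to the true likelihood, by Markov's inequality. -/
theorem dataLaw_evidence_gt_le {φ : ℕ → ℝ → ℝ} {g : ℝ → ℝ} (hg : IsCoefDensity g) {n : ℕ}
    (x : Fin n → ℝ) (θ₀ : ℕ → ℝ) (w : ℕ → ℝ≥0∞) {t : ℝ} (ht : 0 < t) :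
    dataLaw φ x θ₀ {y | ENNReal.ofReal t * likelihood φ x θ₀ y <
      ∑' k, w k * evidence φ g x y k Set.univ} ≤ (∑' k, w k) / ENNReal.ofReal t := by
  let R : ℕ → (Fin n → ℝ) → ℝ≥0∞ := fun k y => ∫⁻ θ, ENNReal.ofReal (Real.exp
    (inner ℝ (fitLin φ x k θ - fitVec φ x θ₀) (noise φ x θ₀ y) -
      ‖fitLin φ x k θ - fitVec φ x θ₀‖ ^ 2 / 2)) ∂(coefPrior g k)
  have hpr := fun k => isProbabilityMeasure_coefPrior hg k
  have hmn := measurable_noise φ x θ₀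
  have hmf := measurable_fitLin φ x
  have hjm : ∀ k, Measurable (Function.uncurry fun (y : Fin n → ℝ) (θ : Fin k → ℝ) =>
      ENNReal.ofReal (Real.exp
      (inner ℝ (fitLin φ x k θ - fitVec φ x θ₀) (noise φ x θ₀ y) -
      ‖fitLin φ x k θ - fitVec φ x θ₀‖ ^ 2 / 2))) := by
    intro k
    have := hmf k
    fun_prop
  have hRm : ∀ k, Measurable (R k) := fun k => (hjm k).lintegral_prod_right'
  have hev : ∀ k y, evidence φ g x y k Set.univ = likelihood φ x θ₀ y * R k y := by
    intro k y
    simp only [evidence, Set.mem_univ, Set.ofPred_true, Measure.restrict_univ, R]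
    rw [← lintegral_const_mul' _ _ (likelihood_ne_top φ x θ₀ y)]
    exact lintegral_congr fun θ => likelihood_eq_mul_exp_inner φ x θ₀ (extend θ) y
  -- Likelihood ratios against the truth have mean one, and Fubini passes this on to their prior
  -- averages.
  have hR1 : ∀ k, ∫⁻ y, R k y ∂(dataLaw φ x θ₀) = 1 := by
    intro k
    simp only [R]
    rw [lintegral_lintegral_swap (hjm k).aemeasurable]
    have : ∀ θ : Fin k → ℝ, ∫⁻ y, ENNReal.ofReal (Real.exp
        (inner ℝ (fitLin φ x k θ - fitVec φ x θ₀) (noise φ x θ₀ y) -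
        ‖fitLin φ x k θ - fitVec φ x θ₀‖ ^ 2 / 2)) ∂(dataLaw φ x θ₀) = 1 := by
      intro θ
      simp only [sub_eq_add_neg _ (‖fitLin φ x k θ - fitVec φ x θ₀‖ ^ 2 / 2), Real.exp_add]
      simp only [ENNReal.ofReal_mul (Real.exp_pos _).le]
      rw [lintegral_mul_const' _ _ ENNReal.ofReal_ne_top, lintegral_exp_inner_noise,
        ← ENNReal.ofReal_mul (Real.exp_pos _).le, ← Real.exp_add]
      simp
    simp [this]
  have hM := meas_ge_le_lintegral_div (μ := dataLaw φ x θ₀) (f := fun y => ∑' k, w k * R k y)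
    (Measurable.tsum fun k => (hRm k).const_mul _).aemeasurable
    (ε := ENNReal.ofReal t) (by simp [ht]) ENNReal.ofReal_ne_top
  rw [lintegral_tsum fun k => ((hRm k).const_mul _).aemeasurable] at hM
  simp only [lintegral_const_mul _ (hRm _), hR1, mul_one] at hM
  refine (measure_mono fun y hy => ?_).trans hM
  simp only [Set.mem_ofPred_eq, hev] at hy ⊢
  have e : ∑' k, w k * (likelihood φ x θ₀ y * R k y) =
      likelihood φ x θ₀ y * ∑' k, w k * R k y := by
    rw [← ENNReal.tsum_mul_left]
    exact tsum_congr fun k => by ring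
  rw [e, mul_comm] at hy
  exact ((ENNReal.mul_lt_mul_iff_right (likelihood_pos φ x θ₀ y).ne'
    (likelihood_ne_top φ x θ₀ y)).1 hy).le

/-! ### Least squares and the marginal likelihood -/

/-- `θ` minimizes the residual sum of squares of `v` over `Θ(k)`, as expressed by Pythagoras. -/
def IsLeastSquares (φ : ℕ → ℝ → ℝ) {n : ℕ} (x : Fin n → ℝ) (v : EuclideanSpace ℝ (Fin n)) {k : ℕ}
    (θ : Fin k → ℝ) : Prop :=
  ∀ θ', ‖v - fitLin φ x k θ'‖ ^ 2 = ‖v - fitLin φ x k θ‖ ^ 2 + ‖fitLin φ x k (θ' - θ)‖ ^ 2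

theorem exists_isLeastSquares (φ : ℕ → ℝ → ℝ) {n : ℕ} (x : Fin n → ℝ)
    (v : EuclideanSpace ℝ (Fin n)) (k : ℕ) : ∃ θ : Fin k → ℝ, IsLeastSquares φ x v θ := by
  obtain ⟨θ, hθ⟩ : (fitLin φ x k).range.starProjection v ∈ (fitLin φ x k).range :=
    Submodule.starProjection_apply_mem _ _
  refine ⟨θ, fun θ' => ?_⟩
  have h0 : inner ℝ (v - fitLin φ x k θ) (fitLin φ x k (θ' - θ)) = 0 := by
    rw [hθ]
    exact Submodule.starProjection_inner_eq_zero _ _ ⟨_, rfl⟩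
  have : v - fitLin φ x k θ' = (v - fitLin φ x k θ) - fitLin φ x k (θ' - θ) := by
    rw [map_sub]
    abel
  rw [this, norm_sub_sq_real, h0]
  ring

theorem IsLeastSquares.norm_le {φ : ℕ → ℝ → ℝ} {n : ℕ} {x : Fin n → ℝ}
    {v : EuclideanSpace ℝ (Fin n)} {k : ℕ} {θ : Fin k → ℝ} (h : IsLeastSquares φ x v θ) :
    ‖fitLin φ x k θ‖ ^ 2 ≤ ‖v‖ ^ 2 := by
  have := h 0
  simp only [map_zero, sub_zero, zero_sub, map_neg, norm_neg] at this
  nlinarith [sq_nonneg ‖v - fitLin φ x k θ‖]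

theorem IsLeastSquares.likelihood_eq {φ : ℕ → ℝ → ℝ} {n : ℕ} {x : Fin n → ℝ} {y : Fin n → ℝ} {k : ℕ}
    {θ : Fin k → ℝ} (h : IsLeastSquares φ x (WithLp.toLp 2 y) θ) (θ' : Fin k → ℝ) :
    likelihood φ x (extend θ') y = likelihood φ x (extend θ) y *
      ENNReal.ofReal (Real.exp (-(‖fitLin φ x k (θ' - θ)‖ ^ 2 / 2))) := by
  rw [likelihood_eq_mul_exp φ x (extend θ') (extend θ)]
  have := h θ'
  rw [fitLin_apply, fitLin_apply _ _ _ θ] at this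
  rw [this]
  congr 3
  ring

theorem IsLeastSquares.likelihood_le {φ : ℕ → ℝ → ℝ} {n : ℕ} {x : Fin n → ℝ} {y : Fin n → ℝ} {k : ℕ}
    {θ : Fin k → ℝ} (h : IsLeastSquares φ x (WithLp.toLp 2 y) θ) (θ' : Fin k → ℝ) :
    likelihood φ x (extend θ') y ≤ likelihood φ x (extend θ) y := by
  rw [h.likelihood_eq θ']
  refine mul_le_of_le_one_right' ?_
  rw [ENNReal.ofReal_le_one, Real.exp_le_one_iff]
  have := sq_nonneg ‖fitLin φ x k (θ' - θ)‖
  linarith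

theorem IsCoefDensity.exists_le {g : ℝ → ℝ} (hg : IsCoefDensity g) :
    ∃ G : ℝ, 0 < G ∧ ∀ t, g t ≤ G := by
  obtain ⟨-, -, G₁, G₂, G₃, G₄, q, h1, h2, h3, h4, hq, h⟩ := hg
  refine ⟨G₃, h3, fun t => (h t).2.trans ?_⟩
  refine mul_le_of_le_one_right h3.le ?_
  rw [Real.exp_le_one_iff, neg_nonpos]
  positivity

theorem IsCoefDensity.exists_ge {g : ℝ → ℝ} (hg : IsCoefDensity g) (A : ℝ) :
    ∃ c : ℝ, 0 < c ∧ ∀ t, |t| ≤ A → c ≤ g t := by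
  obtain ⟨-, -, G₁, G₂, G₃, G₄, q, h1, h2, h3, h4, hq, h⟩ := hg
  refine ⟨G₁ * Real.exp (-(G₂ * A ^ q)), by positivity, fun t ht => le_trans ?_ (h t).1⟩
  gcongr

/-- Bounding the prior density by a constant leaves a product of Gaussian integrals, each
insensitive to its centre. -/
theorem lintegral_exp_coefPrior_le {g : ℝ → ℝ} (hg : IsCoefDensity g) {G : ℝ}
    (hG : 0 < G) (hgG : ∀ t, g t ≤ G) {k : ℕ} {b : ℝ} (hb : 0 < b) (m : Fin k → ℝ) :
    ∫⁻ θ, ENNReal.ofReal (Real.exp (-b * ∑ j, (θ j - m j) ^ 2)) ∂(coefPrior g k) ≤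
      ENNReal.ofReal ((G * Real.sqrt (Real.pi / b)) ^ k) := by
  have : IsProbabilityMeasure
      ((volume : Measure ℝ).withDensity fun t => ENNReal.ofReal (g t)) :=
    ⟨by simpa using hg.2.1⟩
  have h1 : ∀ θ : Fin k → ℝ, ENNReal.ofReal (Real.exp (-b * ∑ j, (θ j - m j) ^ 2)) =
      ∏ j, ENNReal.ofReal (Real.exp (-b * (θ j - m j) ^ 2)) := by
    intro θ
    rw [← ENNReal.ofReal_prod_of_nonneg fun i _ => (Real.exp_pos _).le, ← Real.exp_sum,
      Finset.mul_sum]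
  simp only [h1]
  unfold coefPrior
  rw [lintegral_pi_prod _ (fun j t => ENNReal.ofReal (Real.exp (-b * (t - m j) ^ 2)))
    (fun j => by fun_prop), ENNReal.ofReal_pow (by positivity)]
  refine (Finset.prod_le_pow_card _ _ _ fun j _ => ?_).trans_eq (by rw [Finset.card_univ, Fintype.card_fin])
  rw [lintegral_withDensity_eq_lintegral_mul _ hg.1.ennreal_ofReal (by fun_prop)]
  have h2 : ∫⁻ t, ENNReal.ofReal (Real.exp (-b * (t - m j) ^ 2)) =
      ENNReal.ofReal (Real.sqrt (Real.pi / b)) := by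
    rw [lintegral_sub_right_eq_self (fun t => ENNReal.ofReal (Real.exp (-b * t ^ 2))) (m j),
      ← ofReal_integral_eq_lintegral_ofReal (integrable_exp_neg_mul_sq hb)
      (Eventually.of_forall fun t => (Real.exp_pos _).le), integral_gaussian]
  rw [ENNReal.ofReal_mul hG.le, ← h2, ← lintegral_const_mul _ (by fun_prop)]
  refine lintegral_mono fun t => ?_
  simp only [Pi.mul_apply]
  gcongr
  exact hgG t

theorem measurable_likelihood_extend (φ : ℕ → ℝ → ℝ) {n : ℕ} (x y : Fin n → ℝ) (k : ℕ) :
    Measurable fun θ : Fin k → ℝ => likelihood φ x (extend θ) y := by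
  have := measurable_fitLin φ x k
  simp only [SieveRegression.likelihood_eq, ← fitLin_apply]
  fun_prop

theorem evidence_univ_eq (φ : ℕ → ℝ → ℝ) (g : ℝ → ℝ) {n : ℕ} (x y : Fin n → ℝ) (k : ℕ) :
    evidence φ g x y k Set.univ = ∫⁻ θ, likelihood φ x (extend θ) y ∂(coefPrior g k) := by
  simp [evidence]

theorem evidence_le_univ (φ : ℕ → ℝ → ℝ) (g : ℝ → ℝ) {n : ℕ} (x y : Fin n → ℝ) (k : ℕ)
    (B : Set (ℕ → ℝ)) : evidence φ g x y k B ≤ evidence φ g x y k Set.univ := by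
  rw [evidence_univ_eq]
  exact setLIntegral_le_lintegral _ _

theorem evidence_le_of_forall {φ : ℕ → ℝ → ℝ} {g : ℝ → ℝ} (hg : IsCoefDensity g) {n : ℕ}
    (x y : Fin n → ℝ) (k : ℕ) (B : Set (ℕ → ℝ)) (c : ℝ≥0∞)
    (h : ∀ θ : Fin k → ℝ, extend θ ∈ B → likelihood φ x (extend θ) y ≤ c) :
    evidence φ g x y k B ≤ c := by
  have := isProbabilityMeasure_coefPrior hg k
  calc evidence φ g x y k B ≤ ∫⁻ θ in {θ : Fin k → ℝ | extend θ ∈ B}, c ∂(coefPrior g k) :=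
        setLIntegral_mono measurable_const h
    _ ≤ ∫⁻ θ, c ∂(coefPrior g k) := setLIntegral_le_lintegral _ _
    _ = c := by simp

theorem evidence_le_one {φ : ℕ → ℝ → ℝ} {g : ℝ → ℝ} (hg : IsCoefDensity g) {n : ℕ}
    (x y : Fin n → ℝ) (k : ℕ) (B : Set (ℕ → ℝ)) : evidence φ g x y k B ≤ 1 :=
  evidence_le_of_forall hg x y k B 1 fun _ _ => likelihood_le_one φ x _ y

/-- Only subadditivity of the integral over sets is used, so `B` need not be measurable. -/
theorem evidence_union_ge (φ : ℕ → ℝ → ℝ) (g : ℝ → ℝ) {n : ℕ} (x y : Fin n → ℝ) (k : ℕ)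
    (B : Set (ℕ → ℝ)) :
    evidence φ g x y k Set.univ ≤ evidence φ g x y k B + evidence φ g x y k Bᶜ := by
  refine le_trans (le_of_eq ?_) (lintegral_union_le _ _ _)
  unfold evidence
  congr 2
  ext θ
  simp [Classical.em]

theorem evidence_mono (φ : ℕ → ℝ → ℝ) (g : ℝ → ℝ) {n : ℕ} (x y : Fin n → ℝ) (k : ℕ)
    {B B' : Set (ℕ → ℝ)} (h : B ⊆ B') : evidence φ g x y k B ≤ evidence φ g x y k B' :=
  lintegral_mono_set fun _ hθ => h hθ

/-- Upper bound for the marginal likelihood: each coefficient costs a factor of order `n^{-1/2}`. -/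
theorem exists_evidence_le {g : ℝ → ℝ} (hg : IsCoefDensity g) {C₀ : ℝ} (hC₀ : 0 < C₀) :
    ∃ c : ℝ, 0 < c ∧ ∀ (φ : ℕ → ℝ → ℝ) (n : ℕ) (x y : Fin n → ℝ) (K k : ℕ), 0 < n →
      GramCondition φ x C₀ K → k ≤ K → ∀ θ : Fin k → ℝ,
      IsLeastSquares φ x (WithLp.toLp 2 y) θ → evidence φ g x y k Set.univ ≤
        likelihood φ x (extend θ) y * ENNReal.ofReal ((c / Real.sqrt n) ^ k) := by
  obtain ⟨G, hG, hgG⟩ := hg.exists_le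
  -- The lower Gram bound dominates the likelihood by a Gaussian with exponent `n/(2C₀)` per
  -- coordinate, whose integral is `√(2πC₀/n)`.
  refine ⟨G * Real.sqrt (Real.pi * (2 * C₀)), by positivity,
    fun φ n x y K k hn hGr hk θ hθ => ?_⟩
  have hn' : (0 : ℝ) < n := by exact_mod_cast hn
  rw [evidence_univ_eq]
  have hb : 0 < n / (2 * C₀) := by positivity
  have h := lintegral_exp_coefPrior_le hg hG hgG hb θ
  have e : Real.pi / (n / (2 * C₀)) = Real.pi * (2 * C₀) / n := by field_simp
  rw [e, Real.sqrt_div (by positivity), ← mul_div_assoc] at h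
  refine le_trans ?_ (mul_le_mul_right h _)
  rw [← lintegral_const_mul' _ _ (likelihood_ne_top φ x _ y)]
  refine lintegral_mono fun θ' => ?_
  rw [hθ.likelihood_eq θ']
  refine mul_le_mul_right (ENNReal.ofReal_le_ofReal (Real.exp_le_exp.2 ?_)) _
  have := (gram_bounds hn hGr hk (θ' - θ)).1
  simp only [Pi.sub_apply] at this
  have e2 : n / (2 * C₀) * ∑ j, (θ' j - θ j) ^ 2 =
    (C₀⁻¹ * n * ∑ j, (θ' j - θ j) ^ 2) / 2 := by field_simp
  linarith

/-- Lower bound for the marginal likelihood. -/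
theorem exists_le_evidence {g : ℝ → ℝ} (hg : IsCoefDensity g) {C₀ : ℝ} (hC₀ : 0 < C₀) (A : ℝ) :
    ∃ c : ℝ, 0 < c ∧ ∀ (φ : ℕ → ℝ → ℝ) (n : ℕ) (x y : Fin n → ℝ) (K k : ℕ), 0 < n →
      GramCondition φ x C₀ K → k ≤ K → ∀ θ : Fin k → ℝ,
      IsLeastSquares φ x (WithLp.toLp 2 y) θ → (∀ j, |θ j| ≤ A) →
        likelihood φ x (extend θ) y * ENNReal.ofReal ((c / Real.sqrt n) ^ k) ≤
          evidence φ g x y k Set.univ := by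
  -- The box used below extends at most `1/√n ≤ 1` beyond the least squares coefficients.
  obtain ⟨c, hc, hgc⟩ := hg.exists_ge (A + 1)
  refine ⟨Real.exp (-(C₀ / 2)) * c * 2, by positivity, fun φ n x y K k hn hGr hk θ hθ hA => ?_⟩
  have hn' : (0 : ℝ) < n := by exact_mod_cast hn
  have hsn : (1 : ℝ) ≤ Real.sqrt n := by
    rw [Real.one_le_sqrt]
    exact_mod_cast hn
  have hsq : Real.sqrt n ^ 2 = n := Real.sq_sqrt hn'.le
  -- On the box of half-width `1/√n` the upper Gram bound limits the loss in likelihood to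
  -- `e^{-C₀/2}` per coordinate, while the volume supplies `(2/√n)^k`.
  set S : Set (Fin k → ℝ) :=
    Set.univ.pi fun j => Set.Icc (θ j - 1 / Real.sqrt n) (θ j + 1 / Real.sqrt n) with hS
  have hSm : MeasurableSet S := MeasurableSet.univ_pi fun j => measurableSet_Icc
  have hSv : volume S = ENNReal.ofReal ((2 / Real.sqrt n) ^ k) := by
    rw [hS, volume_pi_pi]
    simp only [Real.volume_Icc]
    rw [Finset.prod_congr rfl fun j _ => by
      rw [show θ j + 1 / Real.sqrt n - (θ j - 1 / Real.sqrt n) = 2 / Real.sqrt n by ring]]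
    simp [ENNReal.ofReal_pow (by positivity : 0 ≤ 2 / Real.sqrt n)]
  have hSb : ∀ θ' ∈ S, ∀ j, |θ' j - θ j| ≤ 1 / Real.sqrt n := by
    intro θ' hθ' j
    have := hθ' j (Set.mem_univ j)
    rw [Set.mem_Icc] at this
    rw [abs_le]
    constructor <;> linarith [this.1, this.2]
  have hpt : ∀ θ' ∈ S, likelihood φ x (extend θ) y * ENNReal.ofReal (Real.exp (-(C₀ / 2)) ^ k) *
      ENNReal.ofReal (c ^ k) ≤
      (∏ j, ENNReal.ofReal (g (θ' j))) * likelihood φ x (extend θ') y := by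
    intro θ' hθ'
    rw [hθ.likelihood_eq θ', mul_comm]
    refine mul_le_mul' ?_ (mul_le_mul_right (ENNReal.ofReal_le_ofReal ?_) _)
    · rw [ENNReal.ofReal_pow hc.le]
      refine le_trans (by simp) (Finset.prod_le_prod' fun j _ => ENNReal.ofReal_le_ofReal (hgc _ ?_)
        : ∏ j : Fin k, ENNReal.ofReal c ≤ _)
      have h1 := hSb θ' hθ' j
      have h2 : 1 / Real.sqrt n ≤ 1 := by
        rw [div_le_one (by positivity)]
        exact hsn
      have h3 := abs_add_le (θ j) (θ' j - θ j)
      rw [add_sub_cancel] at h3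
      linarith [hA j]
    · rw [← Real.exp_nat_mul, Real.exp_le_exp]
      have h1 := (gram_bounds hn hGr hk (θ' - θ)).2
      have h2 : ∑ j, (θ' - θ) j ^ 2 ≤ k * (1 / n) := by
        refine (Finset.sum_le_card_nsmul _ _ (1 / (n : ℝ)) fun j _ => ?_).trans_eq (by simp)
        have := hSb θ' hθ' j
        rw [Pi.sub_apply, ← sq_abs]
        calc |θ' j - θ j| ^ 2 ≤ (1 / Real.sqrt n) ^ 2 := by gcongr
          _ = 1 / (n : ℝ) := by rw [div_pow, hsq, one_pow]
      have h3 := mul_le_mul_of_nonneg_left h2 (by positivity : 0 ≤ C₀ * n)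
      have h4 : C₀ * n * (k * (1 / n)) = C₀ * k := by field_simp
      linarith
  have hgm : Measurable fun θ : Fin k → ℝ => ∏ j, ENNReal.ofReal (g (θ j)) :=
    Finset.measurable_fun_prod _ fun j _ => (hg.1.comp (measurable_pi_apply j)).ennreal_ofReal
  rw [evidence_univ_eq, coefPrior_eq_withDensity hg, lintegral_withDensity_eq_lintegral_mul _ hgm
    (measurable_likelihood_extend φ x y k)]
  refine le_trans ?_ (setLIntegral_le_lintegral S _)
  refine le_trans ?_ (setLIntegral_mono' hSm hpt)
  have e : (Real.exp (-(C₀ / 2)) * c * 2 / Real.sqrt n) ^ k =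
      Real.exp (-(C₀ / 2)) ^ k * (c ^ k * (2 / Real.sqrt n) ^ k) := by
    rw [← mul_pow, ← mul_pow]
    ring
  rw [setLIntegral_const, hSv, e, ENNReal.ofReal_mul (by positivity),
    ENNReal.ofReal_mul (by positivity), ← mul_assoc, ← mul_assoc]

/-- Upper bound for the integral of the likelihood over a ball with arbitrary centre. -/
theorem exists_evidence_ball_le {g : ℝ → ℝ} (hg : IsCoefDensity g) {C₀ : ℝ} (hC₀ : 0 < C₀) :
    ∃ c : ℝ, 0 < c ∧ ∀ (φ : ℕ → ℝ → ℝ) (n : ℕ) (x y : Fin n → ℝ) (K k : ℕ), 0 < n →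
      GramCondition φ x C₀ K → 0 < k → k ≤ K → ∀ θ : Fin k → ℝ,
      IsLeastSquares φ x (WithLp.toLp 2 y) θ → ∀ (ctr : ℕ → ℝ) (r : ℝ), 0 < r →
        evidence φ g x y k {θ' | empDist φ x θ' ctr ≤ r} ≤
          likelihood φ x (extend θ) y * ENNReal.ofReal ((c * r / Real.sqrt k) ^ k) := by
  obtain ⟨G, hG, hgG⟩ := hg.exists_le
  refine ⟨Real.exp (1 / 2) * G * Real.sqrt (Real.pi * (8 * C₀)), by positivity,
    fun φ n x y K k hn hGr hk0 hk θ hθ ctr r hr => ?_⟩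
  have hn' : (0 : ℝ) < n := by exact_mod_cast hn
  have hk' : (0 : ℝ) < k := by exact_mod_cast hk0
  -- The centre may lie outside the sieve, so the ball is recentred at one of its own points in
  -- `Θ(k)`, at the price of doubling the radius.
  by_cases hne : ∃ θ₁ : Fin k → ℝ, empDist φ x (extend θ₁) ctr ≤ r
  swap
  · push Not at hne
    have : {θ' : Fin k → ℝ | extend θ' ∈ {θ' | empDist φ x θ' ctr ≤ r}} = ∅ := by
      ext θ'
      simp [hne θ']
    simp only [evidence, this, Measure.restrict_empty, lintegral_zero_measure, zero_le]
  obtain ⟨θ₁, hθ₁⟩ := hne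
  have hb : 0 < k / (8 * C₀ * r ^ 2) := by positivity
  -- Gaussian domination of the indicator: on the ball the coefficients are within squared distance
  -- `4C₀r²` of `θ₁`, so this `b` keeps the exponent below `k/2`. The integral is then of order
  -- `(r/√k)^k`, as for the volume of a ball.
  set b := k / (8 * C₀ * r ^ 2) with hb_def
  have hball : ∀ θ' : Fin k → ℝ, empDist φ x (extend θ') ctr ≤ r →
      b * ∑ j, (θ' j - θ₁ j) ^ 2 ≤ k / 2 := by
    intro θ' hθ'
    have h1 : empDist φ x (extend θ') (extend θ₁) ≤ 2 * r := by
      have := empDist_triangle φ x (extend θ') ctr (extend θ₁)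
      rw [empDist_comm φ x ctr] at this
      linarith
    have h2 : empDist φ x (extend θ') (extend θ₁) ^ 2 ≤ (2 * r) ^ 2 :=
      pow_le_pow_left₀ (empDist_nonneg _ _ _ _) h1 2
    rw [empDist_sq, ← fitLin_apply, ← fitLin_apply, ← map_sub, div_le_iff₀ hn'] at h2
    have h3 := (gram_bounds hn hGr hk (θ' - θ₁)).1.trans h2
    simp only [Pi.sub_apply] at h3
    have h4 : ∑ j, (θ' j - θ₁ j) ^ 2 ≤ 4 * C₀ * r ^ 2 := by
      field_simp at h3
      linarith
    calc b * ∑ j, (θ' j - θ₁ j) ^ 2 ≤ b * (4 * C₀ * r ^ 2) := by gcongr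
      _ = k / 2 := by
        rw [hb_def]
        field_simp
        norm_num
  have hI := lintegral_exp_coefPrior_le hg hG hgG hb θ₁
  calc evidence φ g x y k {θ' | empDist φ x θ' ctr ≤ r}
      ≤ ∫⁻ θ' in {θ' : Fin k → ℝ | extend θ' ∈ {θ' | empDist φ x θ' ctr ≤ r}},
          likelihood φ x (extend θ) y * ENNReal.ofReal (Real.exp (k / 2)) * ENNReal.ofReal
            (Real.exp (-b * ∑ j, (θ' j - θ₁ j) ^ 2)) ∂(coefPrior g k) := by
        refine setLIntegral_mono (by fun_prop) fun θ' hθ' => ?_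
        rw [mul_assoc, ← ENNReal.ofReal_mul (by positivity), ← Real.exp_add]
        refine (hθ.likelihood_le θ').trans (le_mul_of_one_le_right' ?_)
        rw [ENNReal.one_le_ofReal, Real.one_le_exp_iff]
        linarith [hball θ' hθ']
    _ ≤ ∫⁻ θ', likelihood φ x (extend θ) y * ENNReal.ofReal (Real.exp (k / 2)) * ENNReal.ofReal
            (Real.exp (-b * ∑ j, (θ' j - θ₁ j) ^ 2)) ∂(coefPrior g k) :=
        setLIntegral_le_lintegral _ _
    _ ≤ likelihood φ x (extend θ) y * ENNReal.ofReal (Real.exp (k / 2)) *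
          ENNReal.ofReal ((G * Real.sqrt (Real.pi / b)) ^ k) := by
        rw [lintegral_const_mul' _ _
          (ENNReal.mul_ne_top (likelihood_ne_top φ x _ y) ENNReal.ofReal_ne_top)]
        exact mul_le_mul_right hI _
    _ = _ := by
        rw [mul_assoc, ← ENNReal.ofReal_mul (by positivity)]
        congr 2
        have e1 : Real.pi / b = Real.pi * (8 * C₀) * r ^ 2 / k := by
          rw [hb_def]
          field_simp
        have e2 : Real.exp (k / 2) = Real.exp (1 / 2) ^ k := by
          rw [← Real.exp_nat_mul]
          ring_nf
        rw [e1, e2, ← mul_pow, Real.sqrt_div (by positivity), Real.sqrt_mul (by positivity),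
          Real.sqrt_sq hr.le]
        ring

/-! ### Posterior bounds for fixed data -/

/-- Allows empirical Bayes to be treated as a hierarchical posterior, with a prior on the dimension
that depends on the data. -/
theorem condPosterior_eq_hierPosterior_dirac (φ : ℕ → ℝ → ℝ) (g : ℝ → ℝ) {n : ℕ}
    (x y : Fin n → ℝ) (k : ℕ) (B : Set (ℕ → ℝ)) :
    condPosterior φ g x y k B = hierPosterior φ g (Measure.dirac k) x y B := by
  have h : ∀ B, ∑' j, Measure.dirac k {j} * evidence φ g x y j B = evidence φ g x y k B := by
    intro B
    rw [tsum_eq_single k]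
    · simp
    · intro j hj
      simp [Ne.symm hj]
  simp only [condPosterior, hierPosterior, h]

theorem tsum_mul_evidence_le_one {φ : ℕ → ℝ → ℝ} {g : ℝ → ℝ} (hg : IsCoefDensity g)
    {ρ : Measure ℕ} [IsProbabilityMeasure ρ] {n : ℕ} (x y : Fin n → ℝ) (B : Set (ℕ → ℝ)) :
    ∑' k, ρ {k} * evidence φ g x y k B ≤ 1 := by
  refine (ENNReal.tsum_le_tsum fun k =>
    mul_le_mul_right (evidence_le_one hg x y k B) _).trans_eq ?_
  simp only [mul_one]
  have := lintegral_countable' (μ := ρ) (fun _ : ℕ => (1 : ℝ≥0∞))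
  simpa using this.symm

theorem one_le_hierPosterior_add_compl {φ : ℕ → ℝ → ℝ} {g : ℝ → ℝ} (hg : IsCoefDensity g)
    {ρ : Measure ℕ} [IsProbabilityMeasure ρ] {n : ℕ} (x y : Fin n → ℝ)
    (hS : 0 < ∑' k, ρ {k} * evidence φ g x y k Set.univ) (B : Set (ℕ → ℝ)) :
    1 ≤ hierPosterior φ g ρ x y B + hierPosterior φ g ρ x y Bᶜ := by
  have hfin := ne_top_of_le_ne_top ENNReal.one_ne_top
    (tsum_mul_evidence_le_one (φ := φ) hg (ρ := ρ) x y Set.univ)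
  simp only [hierPosterior]
  rw [← ENNReal.add_div, ← ENNReal.tsum_add, ← ENNReal.div_self hS.ne' hfin]
  refine ENNReal.div_le_div_right (ENNReal.tsum_le_tsum fun k => ?_) _
  rw [← mul_add]
  exact mul_le_mul_right (evidence_union_ge φ g x y k B) _

theorem hierPosterior_mono (φ : ℕ → ℝ → ℝ) (g : ℝ → ℝ) (ρ : Measure ℕ) {n : ℕ}
    (x y : Fin n → ℝ) {B B' : Set (ℕ → ℝ)} (h : B ⊆ B') :
    hierPosterior φ g ρ x y B ≤ hierPosterior φ g ρ x y B' :=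
  ENNReal.div_le_div_right (ENNReal.tsum_le_tsum fun k =>
    mul_le_mul_right (evidence_mono φ g x y k h) _) _

/-- Bound on a posterior probability from bounds on the evidence for `k ≤ K`, on the tail `k > K`
and on the total evidence. -/
theorem hierPosterior_le {φ : ℕ → ℝ → ℝ} {g : ℝ → ℝ} {ρ : Measure ℕ}
    [IsProbabilityMeasure ρ] (hρ0 : ρ {0} = 0) {n : ℕ} (x y : Fin n → ℝ) (θ₀ : ℕ → ℝ) {K : ℕ}
    {B : Set (ℕ → ℝ)} {η t s : ℝ} (hη : 0 ≤ η) (ht : 0 ≤ t) (hs : 0 < s)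
    (hev : ∀ k, 1 ≤ k → k ≤ K → evidence φ g x y k B ≤
      ENNReal.ofReal η * evidence φ g x y k Set.univ + ENNReal.ofReal t * likelihood φ x θ₀ y)
    (htail : ∑' k, (if K < k then ρ {k} else 0) * evidence φ g x y k Set.univ ≤
      ENNReal.ofReal t * likelihood φ x θ₀ y)
    (hS : ENNReal.ofReal s * likelihood φ x θ₀ y ≤ ∑' k, ρ {k} * evidence φ g x y k Set.univ) :
    hierPosterior φ g ρ x y B ≤ ENNReal.ofReal (η + 2 * t / s) := by
  have h1 : ∑' k, ρ {k} = 1 := by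
    have := lintegral_countable' (μ := ρ) (fun _ : ℕ => (1 : ℝ≥0∞))
    simpa using this.symm
  have hnum : ∑' k, ρ {k} * evidence φ g x y k B ≤
      ENNReal.ofReal η * (∑' k, ρ {k} * evidence φ g x y k Set.univ) +
        ENNReal.ofReal t * likelihood φ x θ₀ y + ENNReal.ofReal t * likelihood φ x θ₀ y := by
    have hpt : ∀ k, ρ {k} * evidence φ g x y k B ≤
        (ENNReal.ofReal η * (ρ {k} * evidence φ g x y k Set.univ) +
          ρ {k} * (ENNReal.ofReal t * likelihood φ x θ₀ y)) +
          (if K < k then ρ {k} else 0) * evidence φ g x y k Set.univ := by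
      intro k
      rcases Nat.eq_zero_or_pos k with rfl | hk
      · simp [hρ0]
      by_cases hkK : k ≤ K
      · refine le_trans (mul_le_mul_right (hev k hk hkK) _) (le_trans (le_of_eq ?_) le_self_add)
        ring
      · rw [if_pos (not_le.1 hkK)]
        exact (mul_le_mul_right (evidence_le_univ φ g x y k B) _).trans le_add_self
    refine (ENNReal.tsum_le_tsum hpt).trans ?_
    rw [ENNReal.tsum_add, ENNReal.tsum_add, ENNReal.tsum_mul_left, ENNReal.tsum_mul_right, h1,
      one_mul]
    gcongr
  unfold hierPosterior
  refine ENNReal.div_le_of_le_mul (hnum.trans ?_)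
  rw [ENNReal.ofReal_add hη (by positivity), add_mul, add_assoc]
  refine add_le_add_right ?_ _
  refine le_trans ?_ (mul_le_mul_right hS _)
  rw [← mul_assoc, ← ENNReal.ofReal_mul (by positivity), ← add_mul,
    ← ENNReal.ofReal_add ht ht]
  refine mul_le_mul_left (ENNReal.ofReal_le_ofReal (le_of_eq ?_)) _
  field_simp
  ring

/-! ### Bias -/

theorem bddBelow_bias (φ : ℕ → ℝ → ℝ) {n : ℕ} (x : Fin n → ℝ) (θ₀ : ℕ → ℝ) (k : ℕ) :
    BddBelow (Set.range fun θ : Fin k → ℝ => empDist φ x θ₀ (extend θ) ^ 2) :=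
  ⟨0, by rintro _ ⟨θ, rfl⟩; exact sq_nonneg _⟩

theorem bias_nonneg (φ : ℕ → ℝ → ℝ) {n : ℕ} (x : Fin n → ℝ) (θ₀ : ℕ → ℝ) (k : ℕ) :
    0 ≤ bias φ x θ₀ k := Real.iInf_nonneg fun _ => sq_nonneg _

theorem bias_le (φ : ℕ → ℝ → ℝ) {n : ℕ} (x : Fin n → ℝ) (θ₀ : ℕ → ℝ) {k : ℕ} (θ : Fin k → ℝ) :
    bias φ x θ₀ k ≤ empDist φ x θ₀ (extend θ) ^ 2 := ciInf_le (bddBelow_bias φ x θ₀ k) θ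

theorem IsLeastSquares.norm_sq_le_bias {φ : ℕ → ℝ → ℝ} {n : ℕ} (hn : 0 < n) {x : Fin n → ℝ}
    {θ₀ : ℕ → ℝ} {k : ℕ} {θ : Fin k → ℝ} (h : IsLeastSquares φ x (fitVec φ x θ₀) θ) :
    ‖fitVec φ x θ₀ - fitLin φ x k θ‖ ^ 2 ≤ n * bias φ x θ₀ k := by
  have hn' : (0 : ℝ) < n := by exact_mod_cast hn
  rw [← div_le_iff₀' hn']
  refine le_ciInf fun θ' => ?_
  rw [empDist_sq]
  refine div_le_div_of_nonneg_right ?_ hn'.le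
  rw [← fitLin_apply, h θ']
  nlinarith [sq_nonneg ‖fitLin φ x k (θ' - θ)‖]

theorem le_norm_sq_of_bias {φ : ℕ → ℝ → ℝ} {n : ℕ} (hn : 0 < n) (x : Fin n → ℝ)
    (θ₀ : ℕ → ℝ) {k : ℕ} (θ : Fin k → ℝ) :
    n * bias φ x θ₀ k ≤ ‖fitVec φ x (extend θ) - fitVec φ x θ₀‖ ^ 2 := by
  have hn' : (0 : ℝ) < n := by exact_mod_cast hn
  have := bias_le φ x θ₀ θ
  rw [empDist_sq, le_div_iff₀' hn', norm_sub_rev] at this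
  exact this

theorem bias_antitone (φ : ℕ → ℝ → ℝ) {n : ℕ} (x : Fin n → ℝ) (θ₀ : ℕ → ℝ) :
    Antitone (bias φ x θ₀) := by
  intro k k' hk
  refine le_ciInf fun θ => ?_
  refine (bias_le φ x θ₀ (fun j : Fin k' => extend θ j)).trans_eq ?_
  congr 2
  ext j
  simp only [extend]
  split_ifs <;> first | rfl | omega

/-! ### Marginal likelihoods relative to the true likelihood -/

/-- The prior is a probability measure, so the pointwise likelihood bound integrates at no cost; no
Gram condition is needed. -/
theorem evidence_le_of_norm_ge {φ : ℕ → ℝ → ℝ} {g : ℝ → ℝ} (hg : IsCoefDensity g) {n : ℕ}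
    (x y : Fin n → ℝ) (θ₀ : ℕ → ℝ) (k : ℕ) (B : Set (ℕ → ℝ)) {a : ℝ}
    (h : ∀ θ : Fin k → ℝ, extend θ ∈ B → a ≤ ‖fitVec φ x (extend θ) - fitVec φ x θ₀‖ ^ 2) :
    evidence φ g x y k B ≤
      ENNReal.ofReal (Real.exp (noiseSq φ x θ₀ k y - a / 4)) * likelihood φ x θ₀ y := by
  refine evidence_le_of_forall hg x y k B _ fun θ hθ => ?_
  rw [mul_comm]
  refine (likelihood_extend_le φ x θ₀ y θ).trans
    (mul_le_mul_right (ENNReal.ofReal_le_ofReal (Real.exp_le_exp.2 ?_)) _)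
  linarith [h θ hθ]

theorem div_sqrt_pow_eq_exp {c : ℝ} (hc : 0 < c) {n : ℕ} (hn : 0 < n) (k : ℕ) :
    (c / Real.sqrt n) ^ k = Real.exp (k * (Real.log c - Real.log n / 2)) := by
  have hn' : (0 : ℝ) < n := by exact_mod_cast hn
  have hs : 0 < Real.sqrt n := Real.sqrt_pos.2 hn'
  rw [Real.exp_nat_mul, Real.exp_sub, Real.exp_log hc, ← Real.log_sqrt hn'.le, Real.exp_log hs]

theorem pos_of_one_le_log {n : ℕ} (h : 1 ≤ Real.log n) : 0 < n := by
  rcases Nat.eq_zero_or_pos n with rfl | h0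
  · norm_num at h
  · exact h0

theorem exists_evidence_le_exp {g : ℝ → ℝ} (hg : IsCoefDensity g) {C₀ : ℝ} (hC₀ : 0 < C₀) :
    ∃ ℓ : ℝ, 1 ≤ ℓ ∧ ∀ (φ : ℕ → ℝ → ℝ) (n : ℕ) (x y : Fin n → ℝ) (θ₀ : ℕ → ℝ) (K k : ℕ),
      ℓ ≤ Real.log n → GramCondition φ x C₀ K → k ≤ K →
      noiseSq φ x θ₀ k y ≤ k * Real.log n / 8 →
      evidence φ g x y k Set.univ ≤
        ENNReal.ofReal (Real.exp (-(k * Real.log n / 4))) * likelihood φ x θ₀ y := by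
  obtain ⟨c, hc, h⟩ := exists_evidence_le hg hC₀
  refine ⟨max 1 (8 * Real.log c), le_max_left _ _, fun φ n x y θ₀ K k hℓ hGr hk hW => ?_⟩
  have hn : 0 < n := pos_of_one_le_log ((le_max_left _ _).trans hℓ)
  obtain ⟨θ, hθ⟩ := exists_isLeastSquares φ x (WithLp.toLp 2 y) k
  refine (h φ n x y K k hn hGr hk θ hθ).trans ?_
  refine (mul_le_mul_left (likelihood_extend_le φ x θ₀ y θ) _).trans ?_
  rw [mul_assoc, mul_comm, div_sqrt_pow_eq_exp hc hn, ← ENNReal.ofReal_mul (by positivity),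
    ← Real.exp_add]
  refine mul_le_mul_left (ENNReal.ofReal_le_ofReal (Real.exp_le_exp.2 ?_)) _
  have h1 := sq_nonneg ‖fitVec φ x (extend θ) - fitVec φ x θ₀‖
  have h2 : 8 * Real.log c ≤ Real.log n := (le_max_right _ _).trans hℓ
  have h3 := mul_le_mul_of_nonneg_left h2 (Nat.cast_nonneg (α := ℝ) k)
  nlinarith

/-- The coefficients of the least squares estimator are bounded. -/
theorem IsLeastSquares.abs_le {φ : ℕ → ℝ → ℝ} {C₀ : ℝ} (hC₀ : 0 < C₀) {n : ℕ} (hn : 0 < n)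
    {x y : Fin n → ℝ} {θ₀ : ℕ → ℝ} {K k : ℕ} (hGr : GramCondition φ x C₀ K) (hk : k ≤ K)
    {M₀ : ℝ} (hM₀ : ‖fitVec φ x θ₀‖ ^ 2 ≤ M₀ * n) (hZ : ‖noise φ x θ₀ y‖ ^ 2 ≤ 4 * n)
    {θ : Fin k → ℝ} (hθ : IsLeastSquares φ x (WithLp.toLp 2 y) θ) (j : Fin k) :
    |θ j| ≤ Real.sqrt (C₀ * (2 * (4 + M₀))) := by
  have hn' : (0 : ℝ) < n := by exact_mod_cast hn
  refine Real.abs_le_sqrt ?_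
  have h1 := (gram_bounds hn hGr hk θ).1.trans hθ.norm_le
  have h2 : ‖(WithLp.toLp 2 y : EuclideanSpace ℝ (Fin n))‖ ^ 2 ≤ 2 * (4 + M₀) * n := by
    have e : (WithLp.toLp 2 y : EuclideanSpace ℝ (Fin n)) = noise φ x θ₀ y + fitVec φ x θ₀ := by
      simp [noise]
    have h3 := norm_add_le (noise φ x θ₀ y) (fitVec φ x θ₀)
    rw [← e] at h3
    have h4 := pow_le_pow_left₀ (norm_nonneg _) h3 2
    nlinarith [sq_nonneg (‖noise φ x θ₀ y‖ - ‖fitVec φ x θ₀‖)]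
  have h5 : θ j ^ 2 ≤ ∑ i, θ i ^ 2 :=
    Finset.single_le_sum (f := fun i => θ i ^ 2) (fun i _ => sq_nonneg _) (Finset.mem_univ j)
  have h6 := h1.trans h2
  field_simp at h6
  linarith

theorem exists_exp_le_evidence {g : ℝ → ℝ} (hg : IsCoefDensity g) {C₀ : ℝ} (hC₀ : 0 < C₀)
    (M₀ : ℝ) :
    ∃ C : ℝ, 0 < C ∧ ∀ (φ : ℕ → ℝ → ℝ) (n : ℕ) (x y : Fin n → ℝ) (θ₀ : ℕ → ℝ) (K k : ℕ),
      1 ≤ Real.log n → GramCondition φ x C₀ K → k ≤ K → ‖fitVec φ x θ₀‖ ^ 2 ≤ M₀ * n →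
      ‖noise φ x θ₀ y‖ ^ 2 ≤ 4 * n → noiseSq φ x θ₀ k y ≤ k * Real.log n / 8 →
      bias φ x θ₀ k ≤ k * Real.log n / n →
      ENNReal.ofReal (Real.exp (-(C * (k * Real.log n)))) * likelihood φ x θ₀ y ≤
        evidence φ g x y k Set.univ := by
  obtain ⟨c, hc, h⟩ := exists_le_evidence hg hC₀ (Real.sqrt (C₀ * (2 * (4 + M₀))))
  -- In units of `k log n`, the projected noise costs `1/16`, the bias `1`, the factor `n^{-k/2}`
  -- costs `1/2`, and `c^k` at most `|log c|` because `log n ≥ 1`.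
  refine ⟨2 + |Real.log c|, by positivity, fun φ n x y θ₀ K k hℓ hGr hk hM₀ hZ hW hb => ?_⟩
  have hn : 0 < n := pos_of_one_le_log hℓ
  have hn' : (0 : ℝ) < n := by exact_mod_cast hn
  obtain ⟨θ, hθ⟩ := exists_isLeastSquares φ x (WithLp.toLp 2 y) k
  obtain ⟨θ₁, hθ₁⟩ := exists_isLeastSquares φ x (fitVec φ x θ₀) k
  refine le_trans ?_ (h φ n x y K k hn hGr hk θ hθ (hθ.abs_le hC₀ hn hGr hk hM₀ hZ))
  -- The least squares fit to the data is at least as likely as the projection `θ₁` of the truth,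
  -- whose distance from the truth is the bias.
  refine le_trans ?_ (mul_le_mul_left
    ((le_likelihood_extend φ x θ₀ y θ₁).trans (hθ.likelihood_le θ₁)) _)
  rw [mul_assoc, mul_comm, div_sqrt_pow_eq_exp hc hn, ← ENNReal.ofReal_mul (by positivity),
    ← Real.exp_add]
  refine mul_le_mul_right (ENNReal.ofReal_le_ofReal (Real.exp_le_exp.2 ?_)) _
  have h1 := hθ₁.norm_sq_le_bias hn
  rw [fitLin_apply, norm_sub_rev] at h1
  rw [le_div_iff₀' hn'] at hb
  have h2 : -(|Real.log c| * Real.log n) ≤ Real.log c := by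
    nlinarith [neg_abs_le (Real.log c), abs_nonneg (Real.log c)]
  have h3 := mul_le_mul_of_nonneg_left h2 (Nat.cast_nonneg (α := ℝ) k)
  have h4 : 0 ≤ k * Real.log n := by positivity
  nlinarith

/-- The bounds for the ball and for the whole sieve carry the same maximal likelihood, which
cancels; the factor `n^{-k/2}` of the latter turns `r/√k` into `r √(n/k)`. -/
theorem exists_evidence_ball_le_mul {g : ℝ → ℝ} (hg : IsCoefDensity g) {C₀ : ℝ} (hC₀ : 0 < C₀)
    (M₀ : ℝ) :
    ∃ C : ℝ, 0 < C ∧ ∀ (φ : ℕ → ℝ → ℝ) (n : ℕ) (x y : Fin n → ℝ) (θ₀ : ℕ → ℝ) (K k : ℕ),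
      0 < n → GramCondition φ x C₀ K → 0 < k → k ≤ K → ‖fitVec φ x θ₀‖ ^ 2 ≤ M₀ * n →
      ‖noise φ x θ₀ y‖ ^ 2 ≤ 4 * n → ∀ (ctr : ℕ → ℝ) (r : ℝ), 0 < r →
      evidence φ g x y k {θ' | empDist φ x θ' ctr ≤ r} ≤
        ENNReal.ofReal ((C * r * Real.sqrt (n / k)) ^ k) * evidence φ g x y k Set.univ := by
  obtain ⟨c, hc, h⟩ := exists_le_evidence hg hC₀ (Real.sqrt (C₀ * (2 * (4 + M₀))))
  obtain ⟨c', hc', h'⟩ := exists_evidence_ball_le hg hC₀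
  refine ⟨c' / c, by positivity, fun φ n x y θ₀ K k hn hGr hk0 hk hM₀ hZ ctr r hr => ?_⟩
  have hn' : (0 : ℝ) < n := by exact_mod_cast hn
  have hk' : (0 : ℝ) < k := by exact_mod_cast hk0
  obtain ⟨θ, hθ⟩ := exists_isLeastSquares φ x (WithLp.toLp 2 y) k
  refine (h' φ n x y K k hn hGr hk0 hk θ hθ ctr r hr).trans ?_
  refine le_trans (le_of_eq ?_) (mul_le_mul_right
    (h φ n x y K k hn hGr hk θ hθ (hθ.abs_le hC₀ hn hGr hk hM₀ hZ)) _)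
  rw [mul_left_comm, ← ENNReal.ofReal_mul (by positivity), ← mul_pow]
  congr 3
  rw [Real.sqrt_div' _ hk'.le]
  field_simp

/-! ### Sobolev classes -/

theorem sobolev_subset {β₀ β L₀ : ℝ} (h : β₀ ≤ β) : sobolev β L₀ ⊆ sobolev β₀ L₀ := by
  rintro θ ⟨hs, hle⟩
  have hpt : ∀ j : ℕ, θ j ^ 2 * ((j : ℝ) + 1) ^ (2 * β₀) ≤ θ j ^ 2 * ((j : ℝ) + 1) ^ (2 * β) := by
    intro j
    refine mul_le_mul_of_nonneg_left (Real.rpow_le_rpow_of_exponent_le ?_ ?_) (sq_nonneg _)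
    · linarith [(Nat.cast_nonneg j : (0 : ℝ) ≤ j)]
    · linarith
  have hs' := Summable.of_nonneg_of_le (fun j => by positivity) hpt hs
  exact ⟨hs', (hs'.tsum_le_tsum hpt hs).trans hle⟩

theorem sum_sq_mul_rpow_le {β L₀ : ℝ} {θ : ℕ → ℝ} (hθ : θ ∈ sobolev β L₀) (s : Finset ℕ) :
    ∑ j ∈ s, θ j ^ 2 * ((j : ℝ) + 1) ^ (2 * β) ≤ L₀ :=
  (hθ.1.sum_le_tsum s fun j _ => by positivity).trans hθ.2

/-- A telescoping substitute for comparing the tail sum of `j^{-(s+1)}` with an integral; it follows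
from `exp u ≥ 1 + u` and `log u ≤ u - 1`. -/
theorem rpow_neg_succ_le {s t : ℝ} (hs : 0 < s) (ht : 0 < t) :
    s * (t + 1) ^ (-(s + 1)) ≤ t ^ (-s) - (t + 1) ^ (-s) := by
  have h1 : t ^ (-s) = (t + 1) ^ (-s) * (t / (t + 1)) ^ (-s) := by
    rw [← Real.mul_rpow (by positivity) (by positivity)]
    congr 1
    field_simp
  have h2 : 1 + s / (t + 1) ≤ (t / (t + 1)) ^ (-s) := by
    rw [Real.rpow_def_of_pos (by positivity)]
    have h3 := Real.log_le_sub_one_of_pos (show 0 < t / (t + 1) by positivity)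
    have h4 : t / (t + 1) - 1 = -(1 / (t + 1)) := by
      field_simp
      ring
    have h5 : s / (t + 1) ≤ Real.log (t / (t + 1)) * -s := by
      rw [h4] at h3
      have := mul_le_mul_of_nonneg_left h3 hs.le
      have e : s * -(1 / (t + 1)) = -(s / (t + 1)) := by ring
      linarith
    linarith [Real.add_one_le_exp (Real.log (t / (t + 1)) * -s)]
  have h6 : (t + 1) ^ (-(s + 1)) = (t + 1) ^ (-s) * (1 / (t + 1)) := by
    rw [neg_add, Real.rpow_add (by positivity), Real.rpow_neg_one, one_div]
  rw [h1, h6]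
  have := mul_le_mul_of_nonneg_left h2 (Real.rpow_nonneg (by positivity : 0 ≤ t + 1) (-s))
  have e : (t + 1) ^ (-s) * (1 + s / (t + 1)) =
    (t + 1) ^ (-s) + s * ((t + 1) ^ (-s) * (1 / (t + 1))) := by ring
  linarith

theorem sum_rpow_neg_le {β : ℝ} (hβ : 1 / 2 < β) {K : ℕ} (hK : 1 ≤ K) (N : ℕ) :
    ∑ j ∈ Finset.range N, (((j + K : ℕ) : ℝ) + 1) ^ (-(2 * β)) ≤
      (K : ℝ) ^ (-(2 * β - 1)) / (2 * β - 1) := by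
  have hs : 0 < 2 * β - 1 := by linarith
  have hK' : (0 : ℝ) < K := by exact_mod_cast hK
  have h : ∀ j ∈ Finset.range N, (((j + K : ℕ) : ℝ) + 1) ^ (-(2 * β)) ≤
      (2 * β - 1)⁻¹ * ((((j + K : ℕ) : ℝ)) ^ (-(2 * β - 1)) -
        (((j + 1 + K : ℕ) : ℝ)) ^ (-(2 * β - 1))) := by
    intro j _
    have := rpow_neg_succ_le hs (show (0 : ℝ) < ((j + K : ℕ) : ℝ) by positivity)
    rw [sub_add_cancel] at this
    have e : ((j + 1 + K : ℕ) : ℝ) = ((j + K : ℕ) : ℝ) + 1 := by push_cast; ring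
    rw [e, inv_mul_eq_div, le_div_iff₀ hs]
    linarith
  refine (Finset.sum_le_sum h).trans ?_
  rw [← Finset.mul_sum,
    Finset.sum_range_sub' (fun j => (((j + K : ℕ) : ℝ)) ^ (-(2 * β - 1))), div_eq_inv_mul]
  refine mul_le_mul_of_nonneg_left ?_ (by positivity)
  have : 0 ≤ ((N + K : ℕ) : ℝ) ^ (-(2 * β - 1)) := by positivity
  simpa using this

/-- The tails of a Sobolev sequence are absolutely summable, with explicit bound. -/
theorem sum_abs_le_of_mem_sobolev {β L₀ : ℝ} (hβ : 1 / 2 < β) {θ : ℕ → ℝ}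
    (hθ : θ ∈ sobolev β L₀) {K : ℕ} (hK : 1 ≤ K) (s : Finset ℕ) :
    ∑ j ∈ s, |θ (j + K)| ≤ Real.sqrt (L₀ * ((K : ℝ) ^ (-(2 * β - 1)) / (2 * β - 1))) := by
  refine Real.le_sqrt_of_sq_le ?_
  have hw : ∀ j : ℕ, (0 : ℝ) < ((j + K : ℕ) : ℝ) + 1 := fun j => by positivity
  have h1 := Finset.sum_mul_sq_le_sq_mul_sq s
    (fun j => |θ (j + K)| * (((j + K : ℕ) : ℝ) + 1) ^ β) (fun j => (((j + K : ℕ) : ℝ) + 1) ^ (-β))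
  have e1 : ∀ j : ℕ, |θ (j + K)| * (((j + K : ℕ) : ℝ) + 1) ^ β * (((j + K : ℕ) : ℝ) + 1) ^ (-β) =
      |θ (j + K)| := by
    intro j
    rw [mul_assoc, ← Real.rpow_add (hw j), add_neg_cancel, Real.rpow_zero, mul_one]
  have e2 : ∀ j : ℕ, (|θ (j + K)| * (((j + K : ℕ) : ℝ) + 1) ^ β) ^ 2 =
      θ (j + K) ^ 2 * (((j + K : ℕ) : ℝ) + 1) ^ (2 * β) := by
    intro j
    rw [mul_pow, sq_abs, ← Real.rpow_mul_natCast (hw j).le]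
    congr 2
    push_cast
    ring
  have e3 : ∀ j : ℕ, ((((j + K : ℕ) : ℝ) + 1) ^ (-β)) ^ 2 =
      (((j + K : ℕ) : ℝ) + 1) ^ (-(2 * β)) := by
    intro j
    rw [← Real.rpow_mul_natCast (hw j).le]
    congr 1
    push_cast
    ring
  simp only [e1, e2, e3] at h1
  have h2 : ∑ j ∈ s, θ (j + K) ^ 2 * (((j + K : ℕ) : ℝ) + 1) ^ (2 * β) ≤ L₀ := by
    have := sum_sq_mul_rpow_le hθ (s.map (addRightEmbedding K))
    simpa using this
  have h3 : ∑ j ∈ s, (((j + K : ℕ) : ℝ) + 1) ^ (-(2 * β)) ≤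
      (K : ℝ) ^ (-(2 * β - 1)) / (2 * β - 1) := by
    obtain ⟨N, hN⟩ := s.exists_nat_subset_range
    exact (Finset.sum_le_sum_of_subset_of_nonneg hN fun j _ _ => by positivity).trans
      (sum_rpow_neg_le hβ hK N)
  refine h1.trans (mul_le_mul h2 h3 (Finset.sum_nonneg fun j _ => by positivity) ?_)
  exact le_trans (Finset.sum_nonneg fun j _ => by positivity) h2

theorem summable_abs_of_mem_sobolev {β L₀ : ℝ} (hβ : 1 / 2 < β) {θ : ℕ → ℝ}
    (hθ : θ ∈ sobolev β L₀) : Summable fun j => |θ j| :=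
  (summable_nat_add_iff 1).1 (summable_of_sum_le (fun _ => abs_nonneg _)
    (sum_abs_le_of_mem_sobolev hβ hθ le_rfl))

theorem abs_regFun_sub_trunc_le {φ : ℕ → ℝ → ℝ} {B : ℝ} {t : ℝ} (hφ : ∀ j, |φ j t| ≤ B)
    {β L₀ : ℝ} (hβ : 1 / 2 < β) {θ : ℕ → ℝ} (hθ : θ ∈ sobolev β L₀) {K : ℕ} (hK : 1 ≤ K) :
    |regFun φ θ t - regFun φ (extend fun j : Fin K => θ j) t| ≤
      B * Real.sqrt (L₀ * ((K : ℝ) ^ (-(2 * β - 1)) / (2 * β - 1))) := by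
  have hB : 0 ≤ B := (abs_nonneg _).trans (hφ 0)
  have hsum := summable_abs_of_mem_sobolev hβ hθ
  have hpt : ∀ j, |θ j * φ j t| ≤ |θ j| * B := fun j => by
    rw [abs_mul]
    exact mul_le_mul_of_nonneg_left (hφ j) (abs_nonneg _)
  have hs : Summable fun j => θ j * φ j t :=
    Summable.of_norm_bounded (hsum.mul_right B) hpt
  have hsK := (summable_nat_add_iff K).2 hsum
  rw [regFun_extend, regFun, ← hs.sum_add_tsum_nat_add K, Finset.sum_range, add_sub_cancel_left]
  have h1 : ‖∑' j, θ (j + K) * φ (j + K) t‖ ≤ ∑' j, |θ (j + K)| * B :=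
    tsum_of_norm_bounded (hsK.mul_right B).hasSum fun j => hpt (j + K)
  rw [Real.norm_eq_abs] at h1
  refine h1.trans ?_
  rw [tsum_mul_right, mul_comm]
  exact mul_le_mul_of_nonneg_left
    (hsK.tsum_le_of_sum_le (sum_abs_le_of_mem_sobolev hβ hθ hK)) hB

theorem norm_fitVec_sub_sq_le {φ : ℕ → ℝ → ℝ} {n : ℕ} {x : Fin n → ℝ} {θ θ' : ℕ → ℝ} {D : ℝ}
    (h : ∀ i, |regFun φ θ (x i) - regFun φ θ' (x i)| ≤ D) :
    ‖fitVec φ x θ - fitVec φ x θ'‖ ^ 2 ≤ D ^ 2 * n := by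
  rw [EuclideanSpace.norm_sq_eq]
  refine (Finset.sum_le_card_nsmul _ _ (D ^ 2) fun i _ => ?_).trans_eq (by simp [mul_comm])
  simp only [fitVec, PiLp.sub_apply, Real.norm_eq_abs]
  exact pow_le_pow_left₀ (abs_nonneg _) (h i) 2

/-- Sobolev classes have bounded fitted vectors. -/
theorem exists_norm_fitVec_sq_le {φ : ℕ → ℝ → ℝ} {B : ℝ}
    (hφ : ∀ j, ∀ t ∈ Set.Icc (0 : ℝ) 1, |φ j t| ≤ B) {β L₀ : ℝ} (hβ : 1 / 2 < β) :
    ∃ M₀ : ℝ, ∀ (n : ℕ) (x : Fin n → ℝ), (∀ i, x i ∈ Set.Icc (0 : ℝ) 1) →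
      ∀ θ ∈ sobolev β L₀, ‖fitVec φ x θ‖ ^ 2 ≤ M₀ * n := by
  -- The first coefficient is split off because the tail bound needs a cut at `K ≥ 1`.
  refine ⟨(B * Real.sqrt (L₀ * (((1 : ℕ) : ℝ) ^ (-(2 * β - 1)) / (2 * β - 1))) +
    Real.sqrt L₀ * B) ^ 2, fun n x hx θ hθ => ?_⟩
  have h0 : fitVec φ x (extend (0 : Fin 0 → ℝ)) = 0 := by
    rw [← fitLin_apply, map_zero]
  have := norm_fitVec_sub_sq_le (φ := φ) (x := x) (θ := θ) (θ' := extend (0 : Fin 0 → ℝ))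
    (D := B * Real.sqrt (L₀ * (((1 : ℕ) : ℝ) ^ (-(2 * β - 1)) / (2 * β - 1))) +
    Real.sqrt L₀ * B) fun i => ?_
  · rwa [h0, sub_zero] at this
  · have h1 := abs_regFun_sub_trunc_le (fun j => hφ j _ (hx i)) hβ hθ (le_refl 1)
    have h2 : |regFun φ (extend fun j : Fin 1 => θ j) (x i)| ≤ Real.sqrt L₀ * B := by
      rw [regFun_extend]
      simp only [Finset.univ_unique, Fin.default_eq_zero, Finset.sum_singleton, Fin.val_zero,
        abs_mul]
      refine mul_le_mul (Real.abs_le_sqrt ?_) (hφ 0 _ (hx i)) (abs_nonneg _) (Real.sqrt_nonneg _)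
      simpa using sum_sq_mul_rpow_le hθ {0}
    have h3 : regFun φ (extend (0 : Fin 0 → ℝ)) (x i) = 0 := by
      rw [regFun_extend]
      simp
    rw [h3, sub_zero]
    calc |regFun φ θ (x i)| = |(regFun φ θ (x i) - regFun φ (extend fun j : Fin 1 => θ j) (x i)) +
          regFun φ (extend fun j : Fin 1 => θ j) (x i)| := by rw [sub_add_cancel]
      _ ≤ _ := (abs_add_le _ _).trans (add_le_add h1 h2)

/-- Truncate at `k`. Coefficients between `k` and `K` are measured by the Gram bound, without loss
in the exponent. Beyond `K` only the uniform bound on the basis is available, and it costs one power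
of `K`. -/
theorem bias_le_of_mem_sobolev {φ : ℕ → ℝ → ℝ} {B : ℝ} {C₀ : ℝ} (hC₀ : 0 < C₀) {n : ℕ}
    (hn : 0 < n) {x : Fin n → ℝ} (hφ : ∀ j i, |φ j (x i)| ≤ B) {K : ℕ}
    (hGr : GramCondition φ x C₀ K) {β L₀ : ℝ} (hβ : 1 / 2 < β) {θ : ℕ → ℝ}
    (hθ : θ ∈ sobolev β L₀) {k : ℕ} (hk1 : 1 ≤ k) (hk : k ≤ K) :
    bias φ x θ k ≤ 2 * C₀ * L₀ * (k : ℝ) ^ (-(2 * β)) +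
      2 * B ^ 2 * L₀ * (K : ℝ) ^ (-(2 * β - 1)) / (2 * β - 1) := by
  have hn' : (0 : ℝ) < n := by exact_mod_cast hn
  have hk' : (0 : ℝ) < k := by exact_mod_cast hk1
  have hL : 0 ≤ L₀ := le_trans (by simp) (sum_sq_mul_rpow_le hθ ∅)
  have hs : 0 < 2 * β - 1 := by linarith
  refine (bias_le φ x θ (fun j : Fin k => θ j)).trans ?_
  rw [empDist_sq, div_le_iff₀ hn']
  have h1 : ‖fitVec φ x θ - fitVec φ x (extend fun j : Fin K => θ j)‖ ^ 2 ≤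
      B ^ 2 * (L₀ * ((K : ℝ) ^ (-(2 * β - 1)) / (2 * β - 1))) * n := by
    refine (norm_fitVec_sub_sq_le fun i =>
      abs_regFun_sub_trunc_le (fun j => hφ j i) hβ hθ (hk1.trans hk)).trans_eq ?_
    rw [mul_pow, Real.sq_sqrt (by positivity)]
  have e : fitVec φ x (extend fun j : Fin K => θ j) - fitVec φ x (extend fun j : Fin k => θ j) =
      fitLin φ x K (fun j : Fin K => if (j : ℕ) < k then 0 else θ j) := by
    have e1 : (extend fun j : Fin k => θ j) =
        extend (fun j : Fin K => if (j : ℕ) < k then θ j else 0) := by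
      ext j
      simp only [extend]
      split_ifs <;> first | rfl | omega
    rw [e1, ← fitLin_apply, ← fitLin_apply, ← map_sub]
    congr 1
    ext j
    simp only [Pi.sub_apply]
    split_ifs <;> simp
  have h2 : ‖fitVec φ x (extend fun j : Fin K => θ j) -
      fitVec φ x (extend fun j : Fin k => θ j)‖ ^ 2 ≤ C₀ * n * ((k : ℝ) ^ (-(2 * β)) * L₀) := by
    rw [e]
    refine (gram_bounds hn hGr le_rfl _).2.trans (mul_le_mul_of_nonneg_left ?_ (by positivity))
    have h3 := sum_sq_mul_rpow_le hθ (Finset.range K)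
    rw [Finset.sum_range] at h3
    refine le_trans ?_ (mul_le_mul_of_nonneg_left h3 (by positivity))
    rw [Finset.mul_sum]
    refine Finset.sum_le_sum fun j _ => ?_
    split_ifs with hj
    · simp only [ne_eq, OfNat.ofNat_ne_zero, not_false_eq_true, zero_pow]
      positivity
    · have h4 : (k : ℝ) ^ (2 * β) ≤ ((j : ℕ) + 1 : ℝ) ^ (2 * β) := by
        refine Real.rpow_le_rpow hk'.le ?_ (by linarith)
        have : k ≤ (j : ℕ) := not_lt.1 hj
        have : (k : ℝ) ≤ (j : ℕ) := by exact_mod_cast this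
        linarith
      rw [mul_left_comm, Real.rpow_neg hk'.le]
      refine le_mul_of_one_le_right (sq_nonneg _) ?_
      rw [inv_mul_eq_div, one_le_div (by positivity)]
      exact h4
  have h5 := norm_sub_le_norm_sub_add_norm_sub (fitVec φ x θ)
    (fitVec φ x (extend fun j : Fin K => θ j)) (fitVec φ x (extend fun j : Fin k => θ j))
  have h6 := pow_le_pow_left₀ (norm_nonneg _) h5 2
  have h7 := add_sq_le (a := ‖fitVec φ x θ - fitVec φ x (extend fun j : Fin K => θ j)‖)
    (b := ‖fitVec φ x (extend fun j : Fin K => θ j) - fitVec φ x (extend fun j : Fin k => θ j)‖)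
  refine (h6.trans (h7.trans (mul_le_mul_of_nonneg_left (add_le_add h1 h2) zero_le_two))).trans_eq ?_
  field_simp
  ring

/-! ### The oracle dimension -/

theorem kOpt_spec {φ : ℕ → ℝ → ℝ} {n : ℕ} {x : Fin n → ℝ} {θ₀ : ℕ → ℝ} {k : ℕ} (hk : 1 ≤ k)
    (h : bias φ x θ₀ k ≤ k * Real.log n / n) :
    1 ≤ kOpt φ x θ₀ ∧ bias φ x θ₀ (kOpt φ x θ₀) ≤ kOpt φ x θ₀ * Real.log n / n ∧
      kOpt φ x θ₀ ≤ k :=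
  ⟨(Nat.sInf_mem (s := {k : ℕ | 1 ≤ k ∧ bias φ x θ₀ k ≤ k * Real.log n / n}) ⟨k, hk, h⟩).1,
    (Nat.sInf_mem (s := {k : ℕ | 1 ≤ k ∧ bias φ x θ₀ k ≤ k * Real.log n / n}) ⟨k, hk, h⟩).2,
    Nat.sInf_le ⟨hk, h⟩⟩

theorem lt_bias_of_lt_kOpt {φ : ℕ → ℝ → ℝ} {n : ℕ} {x : Fin n → ℝ} {θ₀ : ℕ → ℝ} {k : ℕ}
    (hk : 1 ≤ k) (h : k < kOpt φ x θ₀) : k * Real.log n / n < bias φ x θ₀ k := by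
  by_contra hc
  exact absurd (Nat.sInf_le (s := {k : ℕ | 1 ≤ k ∧ bias φ x θ₀ k ≤ k * Real.log n / n})
    ⟨hk, not_lt.1 hc⟩) (not_le.2 h)

theorem eventually_ge_log (a : ℝ) : ∀ᶠ n : ℕ in atTop, a ≤ Real.log n :=
  (Real.tendsto_log_atTop.comp tendsto_natCast_atTop_atTop).eventually_ge_atTop a

theorem eventually_mul_rpow_mul_log_le (C : ℝ) {a b : ℝ} (hab : a < b) :
    ∀ᶠ n : ℕ in atTop, C * (n : ℝ) ^ a * Real.log n ≤ (n : ℝ) ^ b := by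
  have h := (isLittleO_log_rpow_atTop (sub_pos.2 hab)).comp_tendsto
    (tendsto_natCast_atTop_atTop (R := ℝ))
  have h2 := h.bound (show 0 < 1 / (|C| + 1) by positivity)
  filter_upwards [h2, eventually_gt_atTop 0, eventually_ge_log 1] with n hn hn0 hl
  have hn' : (0 : ℝ) < n := by exact_mod_cast hn0
  simp only [Function.comp_apply, Real.norm_eq_abs] at hn
  rw [abs_of_nonneg (show 0 ≤ Real.log n by linarith),
    abs_of_nonneg (show 0 ≤ (n : ℝ) ^ (b - a) by positivity), Real.rpow_sub hn'] at hn
  have h3 : C * Real.log n ≤ (|C| + 1) * Real.log n :=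
    mul_le_mul_of_nonneg_right (by linarith [le_abs_self C]) (by linarith)
  have hp : 0 < (n : ℝ) ^ a := by positivity
  calc C * (n : ℝ) ^ a * Real.log n = (n : ℝ) ^ a * (C * Real.log n) := by ring
    _ ≤ (n : ℝ) ^ a * ((|C| + 1) * (1 / (|C| + 1) * ((n : ℝ) ^ b / (n : ℝ) ^ a))) :=
      mul_le_mul_of_nonneg_left (h3.trans (mul_le_mul_of_nonneg_left hn (by positivity))) hp.le
    _ = (n : ℝ) ^ b := by field_simp

/-- Uniformly over the Sobolev classes, the oracle dimension is at most of the order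
`(n / log n)^{1/(1+2β)}`. -/
theorem exists_kOpt_le {φ : ℕ → ℝ → ℝ} {x : ∀ n, Fin n → ℝ} {K : ℕ → ℕ} {B C₀ β₀ L₀ : ℝ}
    (hx : ∀ n i, x n i ∈ Set.Icc (0 : ℝ) 1)
    (hφ : ∀ j, ∀ t ∈ Set.Icc (0 : ℝ) 1, |φ j t| ≤ B)
    (hβ₀ : 1 / 2 < β₀) (hL₀ : 0 < L₀) (hC₀ : 0 < C₀)
    (hGram : ∀ᶠ n in atTop, GramCondition φ (x n) C₀ (K n))
    (hK : ∀ᶠ n : ℕ in atTop, (n : ℝ) ^ (β₀ / ((1 + 2 * β₀) * (β₀ - 1 / 2))) < (K n : ℝ)) :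
    ∃ C : ℝ, 0 < C ∧ ∀ D : ℝ, ∀ᶠ n : ℕ in atTop, ∀ β, β₀ ≤ β → ∀ θ₀ ∈ sobolev β L₀,
      1 ≤ kOpt φ (x n) θ₀ ∧
      bias φ (x n) θ₀ (kOpt φ (x n) θ₀) ≤ kOpt φ (x n) θ₀ * Real.log n / n ∧
      (kOpt φ (x n) θ₀ : ℝ) ≤ C * ((n : ℝ) / Real.log n) ^ (1 / (1 + 2 * β)) ∧
      D * kOpt φ (x n) θ₀ * Real.log n ≤ K n := by
  have hs₀ : 0 < 2 * β₀ - 1 := by linarith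
  set c := max 1 (2 * C₀ * L₀ + 2 * B ^ 2 * L₀ / (2 * β₀ - 1)) with hc
  have hc1 : 1 ≤ c := le_max_left _ _
  set e := β₀ / ((1 + 2 * β₀) * (β₀ - 1 / 2)) with he
  -- The strict inequality leaves a power of `n` between the oracle dimension and `K`, which absorbs
  -- logarithms and any constant `D`.
  have he1 : 1 / (1 + 2 * β₀) < e := by
    rw [he, div_lt_div_iff₀ (by linarith) (by nlinarith)]
    nlinarith
  refine ⟨2 * c, by linarith, fun D => ?_⟩
  filter_upwards [hGram, hK, eventually_ge_log 1,
    eventually_mul_rpow_mul_log_le (2 * c) he1,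
    eventually_mul_rpow_mul_log_le (max D 0 * (2 * c)) he1] with n hGr hKn hlog hA1 hA2 β hβ θ₀ hθ₀
  have hn : 0 < n := pos_of_one_le_log hlog
  have hn' : (0 : ℝ) < n := by exact_mod_cast hn
  have hn1 : (1 : ℝ) ≤ n := by exact_mod_cast hn
  have hl0 : 0 < Real.log n := by linarith
  have hβ2 : 1 / 2 < β := hβ₀.trans_le hβ
  have hs : 0 < 2 * β - 1 := by linarith
  set a := (n : ℝ) / Real.log n with ha
  have ha1 : 1 ≤ a := by
    rw [ha, one_le_div hl0]
    linarith [Real.log_le_sub_one_of_pos hn']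
  have han : a ≤ n := div_le_self hn'.le hlog
  have ha0 : 0 < a := by linarith
  have hp1 : 1 ≤ a ^ (1 / (1 + 2 * β)) := Real.one_le_rpow ha1 (by positivity)
  -- This `k` balances `k^{-2β}` against `k log n / n`; `c` does not depend on `β`, which makes the
  -- bound uniform over `β ≥ β₀`.
  set k := ⌈c * a ^ (1 / (1 + 2 * β))⌉₊ with hkdef
  have hkl : c * a ^ (1 / (1 + 2 * β)) ≤ k := Nat.le_ceil _
  have hcp : 1 ≤ c * a ^ (1 / (1 + 2 * β)) := one_le_mul_of_one_le_of_one_le hc1 hp1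
  have hku : (k : ℝ) ≤ 2 * c * a ^ (1 / (1 + 2 * β)) := by
    have := Nat.ceil_lt_add_one (show 0 ≤ c * a ^ (1 / (1 + 2 * β)) by linarith)
    linarith
  have hk1 : 1 ≤ k := by
    have : (1 : ℝ) ≤ k := hcp.trans hkl
    exact_mod_cast this
  have hpn : a ^ (1 / (1 + 2 * β)) ≤ (n : ℝ) ^ (1 / (1 + 2 * β₀)) := by
    refine (Real.rpow_le_rpow ha0.le han (by positivity)).trans ?_
    refine Real.rpow_le_rpow_of_exponent_le hn1 ?_
    exact one_div_le_one_div_of_le (by linarith) (by linarith)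
  have hkn : (k : ℝ) ≤ 2 * c * (n : ℝ) ^ (1 / (1 + 2 * β₀)) :=
    hku.trans (by gcongr)
  have hkK : k ≤ K n := by
    have h1 : (k : ℝ) ≤ K n := by
      refine le_trans ?_ hKn.le
      refine le_trans (hkn.trans ?_) hA1
      exact le_mul_of_one_le_right (by positivity) hlog
    exact_mod_cast h1
  have hbias : bias φ (x n) θ₀ k ≤ k * Real.log n / n := by
    refine (bias_le_of_mem_sobolev hC₀ hn (fun j i => hφ j _ (hx n i)) hGr hβ2 hθ₀ hk1 hkK).trans ?_
    have e1 : (k : ℝ) * Real.log n / n = k / a := by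
      rw [ha]
      field_simp
    have h1 : (k : ℝ) ^ (-(2 * β)) ≤ a ^ (-(2 * β / (1 + 2 * β))) := by
      have e2 : a ^ (-(2 * β / (1 + 2 * β))) = (a ^ (1 / (1 + 2 * β))) ^ (-(2 * β)) := by
        rw [← Real.rpow_mul ha0.le]
        congr 1
        ring
      rw [e2]
      refine Real.rpow_le_rpow_of_nonpos (by positivity) ?_ (by linarith)
      exact (le_mul_of_one_le_left (by positivity) hc1).trans hkl
    -- The exponent in the growth condition on `K` makes the remainder beyond `K` no larger than the
    -- squared rate: the condition is exact at `β = β₀` up to logarithms, and only easier for larger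
    -- `β`.
    have h2 : (K n : ℝ) ^ (-(2 * β - 1)) ≤ a ^ (-(2 * β / (1 + 2 * β))) := by
      calc (K n : ℝ) ^ (-(2 * β - 1)) ≤ ((n : ℝ) ^ e) ^ (-(2 * β - 1)) :=
            Real.rpow_le_rpow_of_nonpos (by positivity) hKn.le (by linarith)
        _ = (n : ℝ) ^ (-(e * (2 * β - 1))) := by
            rw [← Real.rpow_mul hn'.le]
            congr 1
            ring
        _ ≤ (n : ℝ) ^ (-(2 * β / (1 + 2 * β))) := by
            refine Real.rpow_le_rpow_of_exponent_le hn1 (neg_le_neg ?_)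
            have h3 : 2 * β / (1 + 2 * β) ≤ 2 * β / (1 + 2 * β₀) := by
              gcongr
            refine h3.trans ?_
            rw [he, div_mul_eq_mul_div, div_le_div_iff₀ (by linarith) (by nlinarith)]
            have : 0 ≤ (1 + 2 * β₀) * (β - β₀) := mul_nonneg (by linarith) (by linarith)
            nlinarith
        _ ≤ a ^ (-(2 * β / (1 + 2 * β))) := by
            refine Real.rpow_le_rpow_of_nonpos ha0 han ?_
            rw [neg_nonpos]
            positivity
    have h4 : (2 * β - 1)⁻¹ ≤ (2 * β₀ - 1)⁻¹ := inv_anti₀ hs₀ (by linarith)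
    have h5 : c * a ^ (-(2 * β / (1 + 2 * β))) ≤ k / a := by
      rw [le_div_iff₀ ha0, mul_assoc, ← Real.rpow_add_one ha0.ne']
      refine le_trans (le_of_eq ?_) hkl
      congr 2
      field_simp
      ring
    rw [e1]
    refine le_trans ?_ h5
    calc 2 * C₀ * L₀ * (k : ℝ) ^ (-(2 * β)) +
          2 * B ^ 2 * L₀ * (K n : ℝ) ^ (-(2 * β - 1)) / (2 * β - 1)
        ≤ 2 * C₀ * L₀ * a ^ (-(2 * β / (1 + 2 * β))) +
          2 * B ^ 2 * L₀ * a ^ (-(2 * β / (1 + 2 * β))) / (2 * β₀ - 1) := by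
          gcongr
      _ = (2 * C₀ * L₀ + 2 * B ^ 2 * L₀ / (2 * β₀ - 1)) * a ^ (-(2 * β / (1 + 2 * β))) := by ring
      _ ≤ c * a ^ (-(2 * β / (1 + 2 * β))) := by
          gcongr
          exact le_max_right _ _
  obtain ⟨r1, r2, r3⟩ := kOpt_spec hk1 hbias
  have r3' : (kOpt φ (x n) θ₀ : ℝ) ≤ k := by exact_mod_cast r3
  refine ⟨r1, r2, r3'.trans hku, le_trans ?_ hKn.le⟩
  refine le_trans ?_ hA2
  rw [mul_assoc (max D 0)]
  gcongr
  · exact le_max_left _ _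
  · exact r3'.trans hkn

/-! ### Priors on the dimension -/

/-- The properties of the prior on the dimension that the posterior analysis uses. -/
structure IsRegularDimPrior (ρ : Measure ℕ) : Prop where
  prob : IsProbabilityMeasure ρ
  zero : ρ {0} = 0
  lower : ∃ C : ℝ, 0 < C ∧ ∀ n k : ℕ, 1 ≤ Real.log n → 1 ≤ k → k ≤ n →
    ENNReal.ofReal (Real.exp (-(C * (k * Real.log n)))) ≤ ρ {k}
  moment : ∃ a : ℝ, 1 < a ∧ ∑' k, ρ {k} * ENNReal.ofReal (a ^ k) ≠ ∞

/-- Conditioning on `k ≥ 1` can only raise the mass of each such `k`, and multiplies moments by at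
most a constant. -/
theorem isRegularDimPrior_cond {μ : Measure ℕ} [IsProbabilityMeasure μ] {m : ℕ → ℝ}
    (hμ : ∀ k, μ {k} = ENNReal.ofReal (m k)) (hm : ∀ k, 0 < m k)
    (hlow : ∃ C : ℝ, 0 < C ∧ ∀ n k : ℕ, 1 ≤ Real.log n → 1 ≤ k → k ≤ n →
      Real.exp (-(C * (k * Real.log n))) ≤ m k)
    (hmom : ∃ a : ℝ, 1 < a ∧ Summable fun k => m k * a ^ k) :
    IsRegularDimPrior (ProbabilityTheory.cond μ {k | 1 ≤ k}) := by
  have hpos : μ {k | 1 ≤ k} ≠ 0 := by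
    refine (lt_of_lt_of_le ?_ (measure_mono (show ({1} : Set ℕ) ⊆ {k | 1 ≤ k} by simp))).ne'
    rw [hμ]
    simpa using hm 1
  have hms : MeasurableSet {k : ℕ | 1 ≤ k} := .of_discrete
  refine ⟨cond_isProbabilityMeasure hpos, ?_, ?_, ?_⟩
  · rw [cond_apply hms]
    have : {k : ℕ | 1 ≤ k} ∩ {0} = ∅ := by
      ext k
      simp only [Set.mem_inter_iff, Set.mem_ofPred_eq, Set.mem_singleton_iff,
        Set.mem_empty_iff_false, iff_false]
      omega
    simp [this]
  · obtain ⟨C, hC, h⟩ := hlow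
    refine ⟨C, hC, fun n k hn hk hkn => ?_⟩
    rw [cond_apply hms]
    have : {k : ℕ | 1 ≤ k} ∩ {k} = {k} := by
      ext j
      simp only [Set.mem_inter_iff, Set.mem_ofPred_eq, Set.mem_singleton_iff]
      omega
    rw [this, hμ]
    refine (ENNReal.ofReal_le_ofReal (h n k hn hk hkn)).trans (le_mul_of_one_le_left' ?_)
    exact ENNReal.one_le_inv.2 prob_le_one
  · obtain ⟨a, ha, h⟩ := hmom
    refine ⟨a, ha, ne_top_of_le_ne_top ?_ (ENNReal.tsum_le_tsum (g := fun k =>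
      (μ {k | 1 ≤ k})⁻¹ * ENNReal.ofReal (m k * a ^ k)) fun k => ?_)⟩
    · rw [ENNReal.tsum_mul_left, ← ENNReal.ofReal_tsum_of_nonneg
        (fun k => mul_nonneg (hm k).le (by positivity)) h]
      exact ENNReal.mul_ne_top (ENNReal.inv_ne_top.2 hpos) ENNReal.ofReal_ne_top
    · rw [cond_apply hms, mul_assoc, ENNReal.ofReal_mul (hm k).le, ← hμ]
      gcongr
      exact Set.inter_subset_right

theorem isRegularDimPrior_of_isDimPrior {ρ : Measure ℕ} (h : IsDimPrior ρ) :
    IsRegularDimPrior ρ := by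
  rcases h with ⟨p, hp0, hp1, rfl⟩ | ⟨r, hr, rfl⟩
  · have h0 : (0 : ℝ) < p := hp0
    have h1 : (p : ℝ) < 1 := hp1
    refine isRegularDimPrior_cond (m := fun k => (1 - (p : ℝ)) ^ k * p)
      (geometricMeasure_singleton hp0.ne')
      (fun k => mul_pos (pow_pos (by linarith) _) h0) ?_ ?_
    · refine ⟨|Real.log (1 - p)| + |Real.log p| + 1, by positivity, fun n k hn hk _ => ?_⟩
      have hk' : (1 : ℝ) ≤ k := by exact_mod_cast hk
      have e : (1 - (p : ℝ)) ^ k * p = Real.exp (k * Real.log (1 - p) + Real.log p) := by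
        rw [Real.exp_add, Real.exp_nat_mul, Real.exp_log (by linarith), Real.exp_log h0]
      rw [e, Real.exp_le_exp]
      have hkn : (k : ℝ) ≤ k * Real.log n := le_mul_of_one_le_right (by linarith) hn
      have a1 := neg_abs_le (Real.log (1 - (p : ℝ)))
      have a2 := neg_abs_le (Real.log (p : ℝ))
      have a3 := mul_le_mul_of_nonneg_left hkn (abs_nonneg (Real.log (1 - (p : ℝ))))
      have a4 := mul_le_mul_of_nonneg_left (hk'.trans hkn) (abs_nonneg (Real.log (p : ℝ)))
      have a5 := mul_le_mul_of_nonneg_left a1 (zero_le_one.trans hk')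
      nlinarith
    · refine ⟨1 + p, by linarith, ?_⟩
      have : Summable fun k : ℕ => (p : ℝ) * ((1 - (p : ℝ)) * (1 + p)) ^ k :=
        (summable_geometric_of_lt_one (mul_nonneg (by linarith) (by linarith))
          (by nlinarith)).mul_left _
      refine this.congr fun k => ?_
      rw [mul_pow]
      ring
  · have hr' : (0 : ℝ) < r := hr
    refine isRegularDimPrior_cond (m := fun k => Real.exp (-r) * (r : ℝ) ^ k / (k.factorial : ℝ))
      (poissonMeasure_singleton r) (fun k => by positivity) ?_ ?_
    · refine ⟨r + |Real.log r| + 1, by positivity, fun n k hn hk hkn => ?_⟩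
      have hk' : (1 : ℝ) ≤ k := by exact_mod_cast hk
      have hn0 : (0 : ℝ) < n := by exact_mod_cast pos_of_one_le_log hn
      -- Here `k ≤ n` is essential: it bounds the factorial by `exp(k log n)`.
      have hfac : (k.factorial : ℝ) ≤ (n : ℝ) ^ k := by
        exact_mod_cast (Nat.factorial_le_pow k).trans (Nat.pow_le_pow_left hkn k)
      have e : Real.exp (-r) * (r : ℝ) ^ k / (n : ℝ) ^ k =
          Real.exp (-r + k * Real.log r - k * Real.log n) := by
        rw [Real.exp_sub, Real.exp_add, Real.exp_nat_mul, Real.exp_nat_mul, Real.exp_log hr',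
          Real.exp_log hn0]
      have e2 : Real.exp (-r) * (r : ℝ) ^ k / (n : ℝ) ^ k ≤
          Real.exp (-r) * (r : ℝ) ^ k / (k.factorial : ℝ) := by gcongr
      refine le_trans ?_ e2
      rw [e, Real.exp_le_exp]
      have hkn : (k : ℝ) ≤ k * Real.log n := le_mul_of_one_le_right (by linarith) hn
      have a1 := mul_le_mul_of_nonneg_left (neg_abs_le (Real.log (r : ℝ))) (zero_le_one.trans hk')
      have a3 := mul_le_mul_of_nonneg_left hkn (abs_nonneg (Real.log (r : ℝ)))
      have a4 := mul_le_mul_of_nonneg_left (hk'.trans hkn) hr'.le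
      nlinarith
    · refine ⟨2, by norm_num, ?_⟩
      refine ((Real.summable_pow_div_factorial (r * 2)).mul_left (Real.exp (-r))).congr fun k => ?_
      rw [mul_pow]
      ring

/-! ### Posterior concentration on the event of typical data -/

/-- Typical data for the truth `θ₀`: the noise is small in all sieve directions, and the
denominator of the posterior for the prior `ρ` on the dimension is not too small. -/
structure TypicalData (φ : ℕ → ℝ → ℝ) (g : ℝ → ℝ) {n : ℕ} (x y : Fin n → ℝ) (θ₀ : ℕ → ℝ) (K : ℕ)
    (ρ : Measure ℕ) (C : ℝ) : Prop where
  prob : IsProbabilityMeasure ρ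
  zero : ρ {0} = 0
  noise_le : ∀ k, 1 ≤ k → k ≤ K → noiseSq φ x θ₀ k y ≤ k * Real.log n / 8
  norm_noise_le : ‖noise φ x θ₀ y‖ ^ 2 ≤ 4 * n
  lower : ENNReal.ofReal (Real.exp (-(C * (kOpt φ x θ₀ * Real.log n)))) * likelihood φ x θ₀ y ≤
    ∑' k, ρ {k} * evidence φ g x y k Set.univ
  tail : ∑' k, (if K < k then ρ {k} else 0) * evidence φ g x y k Set.univ ≤
    ENNReal.ofReal (Real.exp (-((C + 1) * (kOpt φ x θ₀ * Real.log n)))) * likelihood φ x θ₀ y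

/-- The numerator bounds beat the denominator by `exp(-κ log n)`, and `κ ≥ 1` makes this at most
`1/n`. -/
theorem TypicalData.hierPosterior_le {φ : ℕ → ℝ → ℝ} {g : ℝ → ℝ} {n : ℕ} {x y : Fin n → ℝ}
    {θ₀ : ℕ → ℝ} {K : ℕ} {ρ : Measure ℕ} {C : ℝ} (h : TypicalData φ g x y θ₀ K ρ C)
    (hlog : 1 ≤ Real.log n) (hk : 1 ≤ kOpt φ x θ₀) {B : Set (ℕ → ℝ)} {η : ℝ} (hη : 0 ≤ η)
    (hev : ∀ k, 1 ≤ k → k ≤ K → evidence φ g x y k B ≤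
      ENNReal.ofReal η * evidence φ g x y k Set.univ +
      ENNReal.ofReal (Real.exp (-((C + 1) * (kOpt φ x θ₀ * Real.log n)))) *
        likelihood φ x θ₀ y) :
    hierPosterior φ g ρ x y B ≤ ENNReal.ofReal (η + 2 * Real.exp (-Real.log n)) := by
  have := h.prob
  refine (SieveRegression.hierPosterior_le h.zero x y θ₀ hη (Real.exp_pos _).le (Real.exp_pos _)
    hev h.tail h.lower).trans (ENNReal.ofReal_le_ofReal ?_)
  rw [mul_div_assoc, ← Real.exp_sub]
  gcongr
  have hk' : (1 : ℝ) ≤ kOpt φ x θ₀ := by exact_mod_cast hk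
  nlinarith

/-- Posterior contraction around the truth. -/
theorem exists_hierPosterior_far_le {g : ℝ → ℝ} (hg : IsCoefDensity g) {C₀ : ℝ} (hC₀ : 0 < C₀)
    {C : ℝ} (hC : 0 < C) :
    ∃ C₂ ℓ : ℝ, 0 < C₂ ∧ 1 ≤ ℓ ∧ ∀ (φ : ℕ → ℝ → ℝ) (n : ℕ) (x y : Fin n → ℝ) (θ₀ : ℕ → ℝ) (K : ℕ)
      (ρ : Measure ℕ), ℓ ≤ Real.log n → GramCondition φ x C₀ K → 1 ≤ kOpt φ x θ₀ →
      TypicalData φ g x y θ₀ K ρ C →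
      hierPosterior φ g ρ x y
        {θ | empDist φ x θ θ₀ ≤ Real.sqrt (C₂ * (kOpt φ x θ₀ * Real.log n / n))}ᶜ ≤
        ENNReal.ofReal (2 * Real.exp (-Real.log n)) := by
  obtain ⟨ℓ, hℓ, h⟩ := exists_evidence_le_exp hg hC₀
  -- For `k > A κ` the bound `exp(-k log n / 4)` is already below `exp(-(C+1) κ log n)`.
  set A : ℝ := 4 * (C + 1) with hA
  -- For `k ≤ A κ` the noise costs at most `A κ log n / 8`; a quarter of this constant pays for that
  -- and leaves `C + 1`.
  refine ⟨A / 2 + 4 * (C + 1), ℓ, by positivity, hℓ, fun φ n x y θ₀ K ρ hn hGr hk hT => ?_⟩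
  have hlog : 1 ≤ Real.log n := hℓ.trans hn
  have hn0 : 0 < n := pos_of_one_le_log hlog
  have hn' : (0 : ℝ) < n := by exact_mod_cast hn0
  have hkn : (0 : ℝ) ≤ kOpt φ x θ₀ * Real.log n := by positivity
  rw [← zero_add (2 * Real.exp (-Real.log n))]
  refine hT.hierPosterior_le hlog hk le_rfl fun k hk1 hkK => ?_
  rw [ENNReal.ofReal_zero, zero_mul, zero_add]
  have hW := hT.noise_le k hk1 hkK
  by_cases hkA : (k : ℝ) ≤ A * kOpt φ x θ₀
  · refine (evidence_le_of_norm_ge hg x y θ₀ k _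
      (a := (A / 2 + 4 * (C + 1)) * (kOpt φ x θ₀ * Real.log n)) fun θ hθ => ?_).trans
      (mul_le_mul_left (ENNReal.ofReal_le_ofReal (Real.exp_le_exp.2 ?_)) _)
    · simp only [Set.mem_compl_iff, Set.mem_ofPred_eq, not_le] at hθ
      have h1 := Real.lt_sq_of_sqrt_lt hθ
      rw [empDist_sq, lt_div_iff₀ hn'] at h1
      refine le_trans (le_of_eq ?_) h1.le
      field_simp
    · have := mul_le_mul_of_nonneg_right hkA (by linarith : 0 ≤ Real.log n)
      nlinarith
  · refine (evidence_le_univ φ g x y k _).trans ((h φ n x y θ₀ K k hn hGr hkK hW).trans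
      (mul_le_mul_left (ENNReal.ofReal_le_ofReal (Real.exp_le_exp.2 ?_)) _))
    have := mul_le_mul_of_nonneg_right (not_le.1 hkA).le (by linarith : 0 ≤ Real.log n)
    nlinarith

/-- Iterates the polished tail condition; all intermediate dimensions stay in the range where it is
assumed. -/
theorem bias_mul_pow_le {φ : ℕ → ℝ → ℝ} {n : ℕ} {x : Fin n → ℝ} {R₀ k₀ : ℕ} {τ δ : ℝ} {K : ℕ}
    (hR₀ : 2 ≤ R₀) (hτ : 0 < τ) {θ₀ : ℕ → ℝ} (hθ₀ : θ₀ ∈ polishedTail φ x R₀ k₀ τ δ K) {k : ℕ}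
    (hk₀ : k₀ ≤ k) (m : ℕ) (hm : k * R₀ ^ m ≤ kOpt φ x θ₀) :
    bias φ x θ₀ (k * R₀ ^ m) ≤ τ ^ m * bias φ x θ₀ k := by
  induction m with
  | zero => simp
  | succ m ih =>
    have h1 : k * R₀ ^ m ≤ k * R₀ ^ (m + 1) :=
      Nat.mul_le_mul_left k (Nat.pow_le_pow_right (by omega) (Nat.le_succ m))
    have h2 := hθ₀.1 (k * R₀ ^ m)
      (hk₀.trans (Nat.le_mul_of_pos_right k (Nat.pow_pos (by omega)))) (h1.trans hm)
    rw [pow_succ, ← mul_assoc]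
    calc bias φ x θ₀ (k * R₀ ^ m * R₀) ≤ τ * bias φ x θ₀ (k * R₀ ^ m) := h2
      _ ≤ τ * (τ ^ m * bias φ x θ₀ k) := by
        gcongr
        exact ih (h1.trans hm)
      _ = τ ^ (m + 1) * bias φ x θ₀ k := by ring

/-- Under the polished tail condition, small balls have small posterior probability. -/
theorem exists_hierPosterior_ball_le {g : ℝ → ℝ} (hg : IsCoefDensity g) {C₀ : ℝ} (hC₀ : 0 < C₀)
    {C : ℝ} (hC : 0 < C) (M₀ : ℝ) {R₀ k₀ : ℕ} {τ : ℝ} (hR₀ : 2 ≤ R₀) (hk₀ : 1 ≤ k₀) (hτ : 0 < τ)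
    (hτ1 : τ < 1) {η : ℝ} (hη : 0 < η) (hη1 : η ≤ 1) :
    ∃ c : ℝ, 0 < c ∧ ∀ (φ : ℕ → ℝ → ℝ) (n : ℕ) (x y : Fin n → ℝ) (θ₀ : ℕ → ℝ) (K : ℕ)
      (ρ : Measure ℕ) (δ : ℝ), 1 ≤ Real.log n → GramCondition φ x C₀ K → 1 ≤ kOpt φ x θ₀ →
      ‖fitVec φ x θ₀‖ ^ 2 ≤ M₀ * n →
      θ₀ ∈ polishedTail φ x R₀ k₀ τ δ K →
      TypicalData φ g x y θ₀ K ρ C → ∀ ctr : ℕ → ℝ,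
      hierPosterior φ g ρ x y {θ | empDist φ x θ ctr ≤ c * Real.sqrt (kOpt φ x θ₀ / n)} ≤
        ENNReal.ofReal (η + 2 * Real.exp (-Real.log n)) := by
  obtain ⟨D, hD, hball⟩ := exists_evidence_ball_le_mul hg hC₀ M₀
  -- Chosen so that a dimension `k` with `k N ≤ κ` has `n b(k) ≥ 4(C+2) κ log n`. A quarter of this
  -- covers the required `C + 1` and the noise.
  obtain ⟨m, hm⟩ : ∃ m : ℕ, τ ^ m < 1 / (8 * (C + 2)) :=
    exists_pow_lt_of_lt_one (by positivity) hτ1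
  -- The factor `k₀` moves the starting point `k k₀` into the range of the polished tail. The `+ 1`
  -- ensures `k k₀ R₀^m ≤ κ - 1`, where minimality of `κ` bounds the bias from below.
  set N : ℕ := k₀ * R₀ ^ m + 1 with hN
  have hN0 : (0 : ℝ) < N := by positivity
  refine ⟨η / (D * Real.sqrt N), by positivity,
    fun φ n x y θ₀ K ρ δ hlog hGr hk hM₀ hθ₀ hT ctr => ?_⟩
  have hn0 : 0 < n := pos_of_one_le_log hlog
  have hn' : (0 : ℝ) < n := by exact_mod_cast hn0
  set κ := kOpt φ x θ₀ with hκ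
  have hκ1 : (1 : ℝ) ≤ κ := by exact_mod_cast hk
  refine hT.hierPosterior_le hlog hk hη.le fun k hk1 hkK => ?_
  have hk1' : (1 : ℝ) ≤ k := by exact_mod_cast hk1
  by_cases hkN : k * N ≤ κ
  · refine le_trans ?_ le_add_self
    refine (evidence_le_of_norm_ge hg x y θ₀ k _ (a := n * bias φ x θ₀ k) fun θ _ =>
      le_norm_sq_of_bias hn0 x θ₀ θ).trans
      (mul_le_mul_left (ENNReal.ofReal_le_ofReal (Real.exp_le_exp.2 ?_)) _)
    have h1 : k * k₀ * R₀ ^ m + 1 ≤ κ := by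
      calc k * k₀ * R₀ ^ m + 1 ≤ k * k₀ * R₀ ^ m + k := by omega
        _ = k * N := by rw [hN]; ring
        _ ≤ κ := hkN
    have hpos : 1 ≤ k * k₀ * R₀ ^ m :=
      Nat.mul_pos (Nat.mul_pos hk1 hk₀) (Nat.pow_pos (by omega))
    have h2 := bias_mul_pow_le hR₀ hτ hθ₀ (Nat.le_mul_of_pos_left k₀ hk1) m (by omega)
    have h3 : bias φ x θ₀ (κ - 1) ≤ bias φ x θ₀ (k * k₀ * R₀ ^ m) :=
      bias_antitone φ x θ₀ (by omega)
    have h4 : bias φ x θ₀ (k * k₀) ≤ bias φ x θ₀ k :=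
      bias_antitone φ x θ₀ (Nat.le_mul_of_pos_right k hk₀)
    have h5 : ((κ - 1 : ℕ) : ℝ) * Real.log n / n < bias φ x θ₀ (κ - 1) :=
      lt_bias_of_lt_kOpt (by omega) (by omega)
    have h6 : (κ : ℝ) / 2 ≤ ((κ - 1 : ℕ) : ℝ) := by
      rw [Nat.cast_sub hk]
      have : (2 : ℝ) ≤ κ := by exact_mod_cast (show 2 ≤ κ by omega)
      push_cast
      linarith
    have h7 : (κ : ℝ) / 2 * Real.log n ≤ n * (τ ^ m * bias φ x θ₀ k) := by
      have h8 : ((κ - 1 : ℕ) : ℝ) * Real.log n / n ≤ τ ^ m * bias φ x θ₀ k :=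
        h5.le.trans (h3.trans (h2.trans (mul_le_mul_of_nonneg_left h4 (by positivity))))
      rw [div_le_iff₀' hn'] at h8
      exact (mul_le_mul_of_nonneg_right h6 (by linarith)).trans h8
    have hb0 : 0 ≤ n * bias φ x θ₀ k := mul_nonneg hn'.le (bias_nonneg φ x θ₀ k)
    have h9 : (κ : ℝ) / 2 * Real.log n ≤ 1 / (8 * (C + 2)) * (n * bias φ x θ₀ k) := by
      refine h7.trans ?_
      rw [mul_left_comm]
      exact mul_le_mul_of_nonneg_right hm.le hb0
    rw [one_div_mul_eq_div, le_div_iff₀ (by positivity)] at h9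
    have hW := hT.noise_le k hk1 hkK
    have h10 : (k : ℝ) ≤ κ := by
      exact_mod_cast (Nat.le_mul_of_pos_right k (by omega : 0 < N)).trans hkN
    have h11 := mul_le_mul_of_nonneg_right h10 (by linarith : 0 ≤ Real.log n)
    have h12 : 0 ≤ (κ : ℝ) * Real.log n := by positivity
    rw [← hκ]
    nlinarith
  · refine le_trans ?_ le_self_add
    refine (hball φ n x y θ₀ K k hn0 hGr hk1 hkK hM₀ hT.norm_noise_le ctr _
      (by positivity)).trans (mul_le_mul_left (ENNReal.ofReal_le_ofReal ?_) _)
    have h1 : (κ : ℝ) ≤ N * k := by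
      have : κ ≤ k * N := (not_le.1 hkN).le
      rw [mul_comm]
      exact_mod_cast this
    have h2 : D * (η / (D * Real.sqrt N) * Real.sqrt (κ / n)) * Real.sqrt (n / k) ≤ η := by
      have e1 : Real.sqrt (κ / n) * Real.sqrt (n / k) = Real.sqrt (κ / k) := by
        rw [← Real.sqrt_mul (by positivity)]
        congr 1
        field_simp
      have h3 : Real.sqrt (κ / k) ≤ Real.sqrt N :=
        Real.sqrt_le_sqrt ((div_le_iff₀ (by linarith)).2 h1)
      have hsN : 0 < Real.sqrt N := Real.sqrt_pos.2 hN0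
      calc D * (η / (D * Real.sqrt N) * Real.sqrt (κ / n)) * Real.sqrt (n / k)
          = η / Real.sqrt N * (Real.sqrt (κ / n) * Real.sqrt (n / k)) := by
            field_simp
        _ ≤ η / Real.sqrt N * Real.sqrt N := by
            rw [e1]
            gcongr
        _ = η := by field_simp
    calc _ ≤ η ^ k := pow_le_pow_left₀ (by positivity) h2 k
      _ ≤ η := pow_le_of_le_one hη.le hη1 (by omega)

/-! ### Typical data have large probability -/

theorem sum_Icc_pow_le {q : ℝ} (hq0 : 0 ≤ q) (hq : q ≤ 1 / 2) (K : ℕ) :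
    ∑ k ∈ Finset.Icc 1 K, q ^ k ≤ 2 * q := by
  have h : ∀ K : ℕ, ∑ k ∈ Finset.Icc 1 K, q ^ k ≤ 2 * q - q ^ (K + 1) / (1 - q) := by
    intro K
    have h1 : 0 < 1 - q := by linarith
    have e : ∑ k ∈ Finset.Icc 1 K, q ^ k = q / (1 - q) - q ^ (K + 1) / (1 - q) := by
      induction K with
      | zero => simp
      | succ K ih =>
        rw [Finset.sum_Icc_succ_top (by omega), ih]
        field_simp
        ring
    have : q / (1 - q) ≤ 2 * q := by
      rw [div_le_iff₀ h1]
      nlinarith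
    rw [e]
    linarith
  have h1 : 0 < 1 - q := by linarith
  have : 0 ≤ q ^ (K + 1) / (1 - q) := by positivity
  linarith [h K]

/-- The failure probability at `k` is at most `√2 q^k` with `q = √2 n^{-1/32}`, because the
logarithm in the threshold outweighs the dimension. The geometric sum tends to zero however large
`K` is. -/
theorem eventually_noiseSq_le (φ : ℕ → ℝ → ℝ) (x : ∀ n, Fin n → ℝ) (K : ℕ → ℕ) {ε : ℝ}
    (hε : 0 < ε) : ∀ᶠ n : ℕ in atTop, ∀ θ₀ : ℕ → ℝ, dataLaw φ (x n) θ₀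
      {y | ¬ ∀ k, 1 ≤ k → k ≤ K n → noiseSq φ (x n) θ₀ k y ≤ k * Real.log n / 8} ≤
      ENNReal.ofReal ε := by
  have hlim : Tendsto (fun n : ℕ => Real.sqrt 2 * Real.exp (-(Real.log n / 32))) atTop (nhds 0) := by
    have h1 : Tendsto (fun n : ℕ => Real.log n / 32) atTop atTop :=
      (Real.tendsto_log_atTop.comp tendsto_natCast_atTop_atTop).atTop_div_const (by norm_num)
    simpa using (Real.tendsto_exp_neg_atTop_nhds_zero.comp h1).const_mul (Real.sqrt 2)
  have hmin : 0 < min (1 / 2) (ε / 4) := by positivity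
  filter_upwards [hlim.eventually_lt_const hmin] with n hn θ₀
  set q := Real.sqrt 2 * Real.exp (-(Real.log n / 32)) with hq
  have hq0 : 0 ≤ q := by positivity
  have h2 : Real.sqrt 2 ≤ 2 := by
    rw [Real.sqrt_le_left (by norm_num)]
    norm_num
  have hsub : {y | ¬ ∀ k, 1 ≤ k → k ≤ K n → noiseSq φ (x n) θ₀ k y ≤ k * Real.log n / 8} ⊆
      ⋃ k ∈ Finset.Icc 1 (K n), {y | k * Real.log n / 8 < noiseSq φ (x n) θ₀ k y} := by
    intro y hy
    simp only [Set.mem_ofPred_eq, not_forall, not_le] at hy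
    obtain ⟨k, hk1, hkK, hk⟩ := hy
    simp only [Set.mem_iUnion]
    exact ⟨k, Finset.mem_Icc.2 ⟨hk1, hkK⟩, hk⟩
  calc dataLaw φ (x n) θ₀ _ ≤ ∑ k ∈ Finset.Icc 1 (K n), dataLaw φ (x n) θ₀
        {y | k * Real.log n / 8 < noiseSq φ (x n) θ₀ k y} :=
        (measure_mono hsub).trans (measure_biUnion_finset_le _ _)
    _ ≤ ∑ k ∈ Finset.Icc 1 (K n), ENNReal.ofReal (2 * q ^ k) := by
        refine Finset.sum_le_sum fun k _ => ?_
        refine (dataLaw_norm_sq_starProjection_gt φ (x n) θ₀ _ _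
          (finrank_sieveSpan_le φ (x n) θ₀ k)).trans (ENNReal.ofReal_le_ofReal ?_)
        have e : Real.exp (-(k * Real.log n / 8 / 4)) * Real.sqrt 2 ^ (k + 1) =
            Real.sqrt 2 * q ^ k := by
          rw [hq, mul_pow, ← Real.exp_nat_mul, pow_succ]
          have : (k : ℝ) * -(Real.log n / 32) = -(k * Real.log n / 8 / 4) := by ring
          rw [this]
          ring
        rw [e]
        gcongr
    _ = ENNReal.ofReal (2 * ∑ k ∈ Finset.Icc 1 (K n), q ^ k) := by
        rw [Finset.mul_sum, ENNReal.ofReal_sum_of_nonneg fun k _ => by positivity]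
    _ ≤ ENNReal.ofReal ε := by
        refine ENNReal.ofReal_le_ofReal ?_
        have := sum_Icc_pow_le hq0 (hn.le.trans (min_le_left _ _)) (K n)
        have := hn.le.trans (min_le_right _ _)
        linarith

theorem eventually_norm_noise_sq_le (φ : ℕ → ℝ → ℝ) (x : ∀ n, Fin n → ℝ) {ε : ℝ}
    (hε : 0 < ε) : ∀ᶠ n : ℕ in atTop, ∀ θ₀ : ℕ → ℝ, dataLaw φ (x n) θ₀
      {y | ¬ ‖noise φ (x n) θ₀ y‖ ^ 2 ≤ 4 * n} ≤ ENNReal.ofReal ε := by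
  have hr : Real.exp (-1) * Real.sqrt 2 < 1 := by
    rw [Real.exp_neg, inv_mul_lt_one₀ (Real.exp_pos _), Real.sqrt_lt' (Real.exp_pos _)]
    have := Real.exp_one_gt_d9
    nlinarith
  have hlim := tendsto_pow_atTop_nhds_zero_of_lt_one (by positivity) hr
  filter_upwards [hlim.eventually_lt_const hε] with n hn θ₀
  have h := dataLaw_norm_sq_starProjection_gt φ (x n) θ₀ ⊤ (4 * n) (d := n) (by simp)
  simp only [Submodule.starProjection_top, ContinuousLinearMap.coe_id', id] at h
  simp only [not_le]
  refine h.trans (ENNReal.ofReal_le_ofReal (le_trans (le_of_eq ?_) hn.le))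
  rw [mul_pow, ← Real.exp_nat_mul]
  congr 2
  ring

/-- A positive lower Gram bound makes the design map injective. This supplies `k ≤ n` for the lower
bound on the dimension prior. -/
theorem le_of_gramCondition {φ : ℕ → ℝ → ℝ} {n : ℕ} (hn : 0 < n) {x : Fin n → ℝ} {C₀ : ℝ}
    (hC₀ : 0 < C₀) {K : ℕ} (h : GramCondition φ x C₀ K) : K ≤ n := by
  have hn' : (0 : ℝ) < n := by exact_mod_cast hn
  have hinj : Function.Injective (fitLin φ x K) := by
    refine (injective_iff_map_eq_zero _).2 fun θ hθ => ?_
    have h1 := (gram_bounds hn h le_rfl θ).1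
    rw [hθ, norm_zero, zero_pow two_ne_zero] at h1
    have h2 : ∑ j, θ j ^ 2 ≤ 0 := by
      by_contra hc
      have : 0 < C₀⁻¹ * n * ∑ j, θ j ^ 2 := mul_pos (by positivity) (not_le.1 hc)
      linarith
    have h3 := (Finset.sum_eq_zero_iff_of_nonneg fun j _ => sq_nonneg (θ j)).1
      (le_antisymm h2 (Finset.sum_nonneg fun j _ => sq_nonneg _))
    ext j
    exact pow_eq_zero_iff two_ne_zero |>.1 (h3 j (Finset.mem_univ j))
  simpa using LinearMap.finrank_le_finrank_of_injective hinj

/-- For the hierarchical prior, dimensions above `K` carry little evidence. -/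
theorem dataLaw_tail_gt_le {φ : ℕ → ℝ → ℝ} {g : ℝ → ℝ} (hg : IsCoefDensity g) {ρ : Measure ℕ}
    {a : ℝ} (ha : 1 < a) (hmom : ∑' k, ρ {k} * ENNReal.ofReal (a ^ k) ≠ ∞) {n : ℕ}
    (x : Fin n → ℝ) (θ₀ : ℕ → ℝ) (K : ℕ) :
    dataLaw φ x θ₀ {y | ENNReal.ofReal (Real.exp (-(K * Real.log a / 2))) * likelihood φ x θ₀ y <
      ∑' k, (if K < k then ρ {k} else 0) * evidence φ g x y k Set.univ} ≤
      ENNReal.ofReal ((∑' k, ρ {k} * ENNReal.ofReal (a ^ k)).toReal *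
        Real.exp (-(K * Real.log a / 2))) := by
  have ha0 : 0 < a := by linarith
  refine (dataLaw_evidence_gt_le hg x θ₀ _ (Real.exp_pos _)).trans ?_
  set S := ∑' k, ρ {k} * ENNReal.ofReal (a ^ k)
  -- For `k > K` one has `1 ≤ a^k a^{-K}`. Half of the resulting exponent is spent on the Markov
  -- threshold and half remains as probability.
  have h1 : ∑' k, (if K < k then ρ {k} else 0) ≤ S * ENNReal.ofReal (Real.exp (-(K * Real.log a))) := by
    rw [← ENNReal.tsum_mul_right]
    refine ENNReal.tsum_le_tsum fun k => ?_
    split_ifs with hk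
    · rw [mul_assoc, ← ENNReal.ofReal_mul (by positivity)]
      refine le_mul_of_one_le_right' ?_
      rw [ENNReal.one_le_ofReal]
      have e : a ^ k = Real.exp (k * Real.log a) := by
        rw [Real.exp_nat_mul, Real.exp_log ha0]
      rw [e, ← Real.exp_add, Real.one_le_exp_iff]
      have hkK : (K : ℝ) ≤ k := by exact_mod_cast hk.le
      have := mul_le_mul_of_nonneg_right hkK (Real.log_nonneg ha.le)
      linarith
    · exact zero_le
  refine (ENNReal.div_le_div_right h1 _).trans (le_of_eq ?_)
  rw [mul_div_assoc, ← ENNReal.ofReal_div_of_pos (Real.exp_pos _), ← Real.exp_sub,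
    ENNReal.ofReal_mul ENNReal.toReal_nonneg, ENNReal.ofReal_toReal hmom]
  congr 3
  ring

/-- Uniformly over the Sobolev class, the data are typical with large probability and the posterior
is a mixture over the dimension. -/
theorem exists_eventually_typicalData {φ : ℕ → ℝ → ℝ} {x : ∀ n, Fin n → ℝ} {K : ℕ → ℕ} {g : ℝ → ℝ}
    {B C₀ β₀ L₀ : ℝ}
    (hx : ∀ n i, x n i ∈ Set.Icc (0 : ℝ) 1)
    (hφ : ∀ j, ∀ t ∈ Set.Icc (0 : ℝ) 1, |φ j t| ≤ B)
    (hβ₀ : 1 / 2 < β₀) (hL₀ : 0 < L₀) (hC₀ : 0 < C₀)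
    (hGram : ∀ᶠ n in atTop, GramCondition φ (x n) C₀ (K n))
    (hK : ∀ᶠ n : ℕ in atTop, (n : ℝ) ^ (β₀ / ((1 + 2 * β₀) * (β₀ - 1 / 2))) < (K n : ℝ))
    (hg : IsCoefDensity g)
    {post : ∀ n, (Fin n → ℝ) → Set (ℕ → ℝ) → ℝ≥0∞}
    (hpost : IsHierarchical φ g x post ∨ IsEmpiricalBayes φ g x K (sobolev β₀ L₀) post) :
    ∃ C : ℝ, 0 < C ∧ ∀ ε : ℝ, 0 < ε → ∀ᶠ n : ℕ in atTop, ∀ θ₀ ∈ sobolev β₀ L₀,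
      dataLaw φ (x n) θ₀ {y | ¬ ∃ ρ, TypicalData φ g (x n) y θ₀ (K n) ρ C ∧
        ∀ B, post n y B = hierPosterior φ g ρ (x n) y B} ≤ ENNReal.ofReal ε := by
  obtain ⟨M₀, hM₀⟩ := exists_norm_fitVec_sq_le (L₀ := L₀) hφ hβ₀
  obtain ⟨C₁, hC₁, hlow⟩ := exists_exp_le_evidence hg hC₀ M₀
  obtain ⟨Ck, hCk, hkOpt⟩ := exists_kOpt_le hx hφ hβ₀ hL₀ hC₀ hGram hK
  have hdom : ∀ᶠ n : ℕ in atTop, ∀ θ₀ ∈ sobolev β₀ L₀, kOpt φ (x n) θ₀ ≤ K n := by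
    filter_upwards [hkOpt 1, eventually_ge_log 1] with n hn hlog θ₀ hθ₀
    have h := (hn β₀ le_rfl θ₀ hθ₀).2.2.2
    rw [one_mul] at h
    have : (kOpt φ (x n) θ₀ : ℝ) ≤ K n :=
      (le_mul_of_one_le_right (Nat.cast_nonneg _) hlog).trans h
    exact_mod_cast this
  have hlower : ∀ᶠ n : ℕ in atTop, ∀ θ₀ ∈ sobolev β₀ L₀, ∀ y : Fin n → ℝ,
      (∀ k, 1 ≤ k → k ≤ K n → noiseSq φ (x n) θ₀ k y ≤ k * Real.log n / 8) →
      ‖noise φ (x n) θ₀ y‖ ^ 2 ≤ 4 * n →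
      ENNReal.ofReal (Real.exp (-(C₁ * (kOpt φ (x n) θ₀ * Real.log n)))) *
        likelihood φ (x n) θ₀ y ≤ evidence φ g (x n) y (kOpt φ (x n) θ₀) Set.univ := by
    filter_upwards [hkOpt 1, eventually_ge_log 1, hGram, hdom]
      with n hn hlog hGr hd θ₀ hθ₀ y hW hZ
    have h := hn β₀ le_rfl θ₀ hθ₀
    exact hlow φ n (x n) y θ₀ (K n) _ hlog hGr (hd θ₀ hθ₀) (hM₀ n (x n) (hx n) θ₀ hθ₀) hZ
      (hW _ h.1 (hd θ₀ hθ₀)) h.2.1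
  rcases hpost with ⟨ρ, hρ, hp⟩ | ⟨Kbar, khat, hKbar, -, hmax, hp⟩
  · obtain ⟨hprob, hzero, ⟨Cρ, hCρ, hρlow⟩, a, ha, hmom⟩ := isRegularDimPrior_of_isDimPrior hρ
    have hla : 0 < Real.log a := Real.log_pos ha
    refine ⟨C₁ + Cρ, by positivity, fun ε hε => ?_⟩
    have hε3 : 0 < ε / 3 := by positivity
    set S := (∑' k, ρ {k} * ENNReal.ofReal (a ^ k)).toReal
    have hKlim : Tendsto (fun n => (K n : ℝ)) atTop atTop := by
      refine tendsto_atTop_mono' _ (hK.mono fun n hn => hn.le) ?_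
      refine (tendsto_rpow_atTop ?_).comp tendsto_natCast_atTop_atTop
      have : 0 < β₀ - 1 / 2 := by linarith
      positivity
    have hlim : Tendsto (fun n => S * Real.exp (-(K n * Real.log a / 2))) atTop (nhds 0) := by
      have h1 : Tendsto (fun n => K n * Real.log a / 2) atTop atTop :=
        (hKlim.atTop_mul_const hla).atTop_div_const (by norm_num)
      simpa using (Real.tendsto_exp_neg_atTop_nhds_zero.comp h1).const_mul S
    filter_upwards [eventually_noiseSq_le φ x K hε3, eventually_norm_noise_sq_le φ x hε3,
      hlim.eventually_lt_const hε3, hlower, hdom, hkOpt 1, eventually_ge_log 1, hGram,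
      hkOpt (2 * (C₁ + Cρ + 1) / Real.log a)]
      with n h1 h2 h3 hlo hd hk1 hlog hGr hkD θ₀ hθ₀
    have hn0 : 0 < n := pos_of_one_le_log hlog
    have hsub : {y | ¬ ∃ ρ, TypicalData φ g (x n) y θ₀ (K n) ρ (C₁ + Cρ) ∧
        ∀ B, post n y B = hierPosterior φ g ρ (x n) y B} ⊆
        ({y | ¬ ∀ k, 1 ≤ k → k ≤ K n → noiseSq φ (x n) θ₀ k y ≤ k * Real.log n / 8} ∪
        {y | ¬ ‖noise φ (x n) θ₀ y‖ ^ 2 ≤ 4 * n}) ∪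
        {y | ENNReal.ofReal (Real.exp (-(K n * Real.log a / 2))) * likelihood φ (x n) θ₀ y <
          ∑' k, (if K n < k then ρ {k} else 0) * evidence φ g (x n) y k Set.univ} := by
      intro y hy
      by_contra hc
      simp only [Set.mem_union, Set.mem_ofPred_eq, not_or, not_not, not_lt] at hc hy
      obtain ⟨⟨hW, hZ⟩, ht⟩ := hc
      refine hy ⟨ρ, ⟨hprob, hzero, hW, hZ, ?_, ht.trans ?_⟩, hp n y⟩
      · refine le_trans ?_ (ENNReal.le_tsum (kOpt φ (x n) θ₀))
        refine le_trans (le_of_eq ?_) (mul_le_mul' (hρlow n _ hlog (hk1 β₀ le_rfl θ₀ hθ₀).1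
          ((hd θ₀ hθ₀).trans (le_of_gramCondition hn0 hC₀ hGr))) (hlo θ₀ hθ₀ y hW hZ))
        rw [← mul_assoc (ENNReal.ofReal _), ← ENNReal.ofReal_mul (by positivity), ← Real.exp_add]
        congr 3
        ring
      · refine mul_le_mul_left (ENNReal.ofReal_le_ofReal (Real.exp_le_exp.2 ?_)) _
        -- The value of `D` is tuned so that the decay rate `K log a / 2` exceeds `(C₁ + Cρ + 1) κ
        -- log n`.
        have h4 := (hkD β₀ le_rfl θ₀ hθ₀).2.2.2
        have h5 := mul_le_mul_of_nonneg_right h4 hla.le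
        have e : 2 * (C₁ + Cρ + 1) / Real.log a * kOpt φ (x n) θ₀ * Real.log n * Real.log a =
            2 * ((C₁ + Cρ + 1) * (kOpt φ (x n) θ₀ * Real.log n)) := by field_simp
        rw [e] at h5
        linarith
    refine (measure_mono hsub).trans ((measure_union_le _ _).trans ?_)
    refine (add_le_add ((measure_union_le _ _).trans (add_le_add (h1 θ₀) (h2 θ₀)))
      ((dataLaw_tail_gt_le hg ha hmom (x n) θ₀ (K n)).trans
        (ENNReal.ofReal_le_ofReal h3.le))).trans_eq ?_
    rw [← ENNReal.ofReal_add hε3.le hε3.le, ← ENNReal.ofReal_add (by positivity) hε3.le]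
    congr 1
    ring
  · refine ⟨C₁, hC₁, fun ε hε => ?_⟩
    have hε2 : 0 < ε / 2 := by positivity
    filter_upwards [eventually_noiseSq_le φ x K hε2, eventually_norm_noise_sq_le φ x hε2,
      hlower, hKbar, hmax, hkOpt 1] with n h1 h2 hlo hKb hmx hk1 θ₀ hθ₀
    have hsub : {y | ¬ ∃ ρ, TypicalData φ g (x n) y θ₀ (K n) ρ C₁ ∧
        ∀ B, post n y B = hierPosterior φ g ρ (x n) y B} ⊆
        {y | ¬ ∀ k, 1 ≤ k → k ≤ K n → noiseSq φ (x n) θ₀ k y ≤ k * Real.log n / 8} ∪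
        {y | ¬ ‖noise φ (x n) θ₀ y‖ ^ 2 ≤ 4 * n} := by
      intro y hy
      by_contra hc
      simp only [Set.mem_union, Set.mem_ofPred_eq, not_or, not_not] at hc hy
      obtain ⟨hW, hZ⟩ := hc
      obtain ⟨hmem, hge⟩ := hmx y
      rw [Set.mem_Icc] at hmem
      have hsum : ∑' k, Measure.dirac (khat n y) {k} * evidence φ g (x n) y k Set.univ =
          evidence φ g (x n) y (khat n y) Set.univ := by
        rw [tsum_eq_single (khat n y)]
        · simp
        · intro j hj
          simp [Ne.symm hj]
      -- The maximizer has at least the evidence of `κ`, which is in its range, and `khat ≤ Kbar ≤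
      -- K` leaves no tail.
      refine hy ⟨Measure.dirac (khat n y), ⟨inferInstance, ?_, hW, hZ, ?_, ?_⟩, fun B => ?_⟩
      · have : khat n y ≠ 0 := by omega
        simp [this]
      · rw [hsum]
        exact (hlo θ₀ hθ₀ y hW hZ).trans
          (hge _ ⟨(hk1 β₀ le_rfl θ₀ hθ₀).1, hKb.2 θ₀ hθ₀⟩)
      · refine le_trans (le_of_eq ?_) zero_le
        rw [ENNReal.tsum_eq_zero]
        intro k
        split_ifs with hk
        · have : khat n y ≠ k := by have := hKb.1; omega
          simp [this]
        · simp
      · rw [hp, condPosterior_eq_hierPosterior_dirac]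
    refine (measure_mono hsub).trans ((measure_union_le _ _).trans ?_)
    refine (add_le_add (h1 θ₀) (h2 θ₀)).trans_eq ?_
    rw [← ENNReal.ofReal_add hε2.le hε2.le]
    congr 1
    ring

/-! ### Credible radii -/

/-- The infimum defining the credible radius runs over all reals; this bounds its set below. -/
theorem nonneg_of_le_hierPosterior_ball {φ : ℕ → ℝ → ℝ} {g : ℝ → ℝ} {ρ : Measure ℕ} {n : ℕ}
    {x y : Fin n → ℝ} {ctr : ℕ → ℝ} {α r : ℝ} (hα : α < 1)
    (h : ENNReal.ofReal (1 - α) ≤ hierPosterior φ g ρ x y {θ | empDist φ x θ ctr ≤ r}) : 0 ≤ r := by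
  by_contra hr
  have hempty : {θ | empDist φ x θ ctr ≤ r} = (∅ : Set (ℕ → ℝ)) := by
    ext θ
    simp only [Set.mem_ofPred_eq, Set.mem_empty_iff_false, iff_false, not_le]
    exact (not_le.1 hr).trans_le (empDist_nonneg φ x θ ctr)
  rw [hempty] at h
  simp [hierPosterior, evidence] at h
  linarith

/-- By the triangle inequality, contraction around the truth carries over to any nearby centre. This
bounds the credible radius above and shows that the set of admissible radii is nonempty. -/
theorem TypicalData.le_hierPosterior_ball {φ : ℕ → ℝ → ℝ} {g : ℝ → ℝ} (hg : IsCoefDensity g) {n : ℕ}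
    {x y : Fin n → ℝ} {θ₀ : ℕ → ℝ} {K : ℕ} {ρ : Measure ℕ} {C : ℝ}
    (h : TypicalData φ g x y θ₀ K ρ C) {ctr : ℕ → ℝ} {α r s : ℝ} (hα : 0 ≤ α)
    (hr : hierPosterior φ g ρ x y {θ | empDist φ x θ θ₀ ≤ r}ᶜ ≤ ENNReal.ofReal α)
    (hs : empDist φ x θ₀ ctr ≤ s) :
    ENNReal.ofReal (1 - α) ≤ hierPosterior φ g ρ x y {θ | empDist φ x θ ctr ≤ r + s} := by
  have := h.prob
  have hS : 0 < ∑' k, ρ {k} * evidence φ g x y k Set.univ := by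
    refine lt_of_lt_of_le ?_ h.lower
    exact ENNReal.mul_pos (by simp [Real.exp_pos]) (likelihood_pos φ x θ₀ y).ne'
  have h1 := one_le_hierPosterior_add_compl hg x y hS {θ | empDist φ x θ θ₀ ≤ r}
  have h2 : hierPosterior φ g ρ x y {θ | empDist φ x θ θ₀ ≤ r} ≤
      hierPosterior φ g ρ x y {θ | empDist φ x θ ctr ≤ r + s} :=
    hierPosterior_mono φ g ρ x y fun θ hθ =>
      (empDist_triangle φ x θ θ₀ ctr).trans (add_le_add hθ hs)
  rw [ENNReal.ofReal_sub _ hα, ENNReal.ofReal_one]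
  exact tsub_le_iff_right.2 (h1.trans (add_le_add h2 hr))

/-- Subadditivity alone is used, so none of the events has to be measurable. -/
theorem one_sub_le_measure_of_inter {Ω : Type*} [MeasurableSpace Ω] (P : Measure Ω) {F G H : Set Ω}
    {ε : ℝ} (hε : 0 < ε) (hF : 1 - ENNReal.ofReal (ε / 2) ≤ P F)
    (hG : P Gᶜ ≤ ENNReal.ofReal (ε / 2)) (hH : F ∩ G ⊆ H) : 1 - ENNReal.ofReal ε ≤ P H := by
  have h1 : P F ≤ P H + P Gᶜ := by
    refine (measure_mono fun ω hω => ?_).trans (measure_union_le H Gᶜ)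
    by_cases hG' : ω ∈ G
    · exact Or.inl (hH ⟨hω, hG'⟩)
    · exact Or.inr hG'
  rw [tsub_le_iff_right] at hF ⊢
  refine hF.trans ((add_le_add_left (h1.trans (add_le_add_right hG _)) _).trans_eq ?_)
  rw [add_assoc, ← ENNReal.ofReal_add (by positivity) (by positivity)]
  congr 2
  ring

theorem epsRate_le {φ : ℕ → ℝ → ℝ} {n : ℕ} {x : Fin n → ℝ} {θ₀ : ℕ → ℝ} {k : ℕ}
    (h : bias φ x θ₀ k ≤ k * Real.log n / n) :
    epsRate φ x θ₀ k ≤ Real.sqrt 2 * Real.sqrt (k * Real.log n / n) := by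
  rw [epsRate, ← Real.sqrt_mul (by norm_num)]
  exact Real.sqrt_le_sqrt (by linarith)

theorem tendsto_exp_neg_log : Tendsto (fun n : ℕ => 2 * Real.exp (-Real.log n)) atTop (nhds 0) := by
  simpa using (Real.tendsto_exp_neg_atTop_nhds_zero.comp
    (Real.tendsto_log_atTop.comp tendsto_natCast_atTop_atTop)).const_mul 2

end

end SieveRegression

/-! ### Coverage and size of the credible balls -/

open SieveRegression

theorem mainTheorem6
    (φ : ℕ → ℝ → ℝ) (x : ∀ n, Fin n → ℝ) (K : ℕ → ℕ) (g : ℝ → ℝ)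
    (B C₀ β₀ L₀ α : ℝ)
    (hx : ∀ n i, x n i ∈ Set.Icc (0 : ℝ) 1)
    (hφ : ∀ j, ∀ t ∈ Set.Icc (0 : ℝ) 1, |φ j t| ≤ B)
    (hβ₀ : 1 / 2 < β₀) (hL₀ : 0 < L₀) (hα : α ∈ Set.Ioo (0 : ℝ) 1) (hC₀ : 0 < C₀)
    (hGram : ∀ᶠ n in Filter.atTop, SieveRegression.GramCondition φ (x n) C₀ (K n))
    (hK : ∀ᶠ n : ℕ in Filter.atTop,
      (n : ℝ) ^ (β₀ / ((1 + 2 * β₀) * (β₀ - 1 / 2))) < (K n : ℝ))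
    (hg : SieveRegression.IsCoefDensity g)
    (post : ∀ n, (Fin n → ℝ) → Set (ℕ → ℝ) → ENNReal)
    (hpost : SieveRegression.IsHierarchical φ g x post ∨
      SieveRegression.IsEmpiricalBayes φ g x K (SieveRegression.sobolev β₀ L₀) post)
    (θhat : ∀ n, (Fin n → ℝ) → ℕ → ℝ) (hθhat : SieveRegression.IsEstimator θhat) :
    (∀ (R₀ k₀ : ℕ) (τ δ : ℝ), 2 ≤ R₀ → 1 ≤ k₀ → 0 < τ → τ < 1 → δ < min 1 C₀ →
      SieveRegression.CenteringCondition φ x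
        (fun n => SieveRegression.polishedTail φ (x n) R₀ k₀ τ δ (K n) ∩
          SieveRegression.sobolev β₀ L₀) θhat →
      ∀ ε : ℝ, 0 < ε → ∃ L : ℝ, 0 < L ∧
        1 - ENNReal.ofReal ε ≤ Filter.liminf (fun n : ℕ =>
          ⨅ θ₀ ∈ SieveRegression.polishedTail φ (x n) R₀ k₀ τ δ (K n) ∩
              SieveRegression.sobolev β₀ L₀,
            SieveRegression.dataLaw φ (x n) θ₀
              {y | θ₀ ∈ SieveRegression.credBall φ (x n) (post n y) (θhat n y) α
                (L * Real.sqrt (Real.log n))}) Filter.atTop) ∧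
    (SieveRegression.CenteringCondition φ x (fun _ => SieveRegression.sobolev β₀ L₀) θhat →
      ∀ ε : ℝ, 0 < ε → ∃ C : ℝ, 0 < C ∧
        1 - ENNReal.ofReal ε ≤ Filter.liminf (fun n : ℕ =>
          ⨅ β ∈ Set.Ici β₀, ⨅ θ₀ ∈ SieveRegression.sobolev β L₀,
            SieveRegression.dataLaw φ (x n) θ₀
              {y | SieveRegression.empDiam φ (x n)
                  (SieveRegression.credBall φ (x n) (post n y) (θhat n y) α 1) ≤
                ENNReal.ofReal (C * ((n : ℝ) / Real.log n) ^ (-(β / (1 + 2 * β))))})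
          Filter.atTop) := by
  obtain ⟨M₀, hM₀⟩ := exists_norm_fitVec_sq_le (L₀ := L₀) hφ hβ₀
  obtain ⟨C, hC, htyp⟩ := exists_eventually_typicalData hx hφ hβ₀ hL₀ hC₀ hGram hK hg hpost
  obtain ⟨Ck, hCk, hkOpt⟩ := exists_kOpt_le hx hφ hβ₀ hL₀ hC₀ hGram hK
  obtain ⟨C₂, ℓ, hC₂, hℓ, hfar⟩ := exists_hierPosterior_far_le hg hC₀ hC
  constructor
  · intro R₀ k₀ τ δ hR₀ hk₀ hτ hτ1 _ hcen ε hε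
    obtain ⟨M, hM, hcenM⟩ := hcen (ε / 2) (by positivity)
    -- With this `η`, small balls have posterior mass `η + 2/n < 1 - α` for large `n`, so their
    -- radius is not admissible.
    obtain ⟨c, hc, hball⟩ := exists_hierPosterior_ball_le hg hC₀ hC M₀ hR₀ hk₀ hτ hτ1
      (η := (1 - α) / 2) (by linarith [hα.2]) (by linarith [hα.1])
    refine ⟨M * Real.sqrt 2 / c, by positivity, le_liminf_of_le (by isBoundedDefault) ?_⟩
    filter_upwards [hcenM, htyp (ε / 2) (by positivity), hkOpt 1, hGram, eventually_ge_log ℓ,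
      tendsto_exp_neg_log.eventually_lt_const hα.1,
      tendsto_exp_neg_log.eventually_lt_const (show 0 < (1 - α) / 2 by linarith [hα.2])]
      with n hF hG hk hGr hlog hs1 hs2
    refine le_iInf₂ fun θ₀ hθ₀ => one_sub_le_measure_of_inter _ hε (hF θ₀ hθ₀)
      (G := {y | ∃ ρ, TypicalData φ g (x n) y θ₀ (K n) ρ C ∧
        ∀ B, post n y B = hierPosterior φ g ρ (x n) y B}) (hG θ₀ hθ₀.2) ?_
    rintro y ⟨hd, ρ, hT, hp⟩
    obtain ⟨hk1, hb, -, -⟩ := hk β₀ le_rfl θ₀ hθ₀.2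
    have hlog1 : 1 ≤ Real.log n := hℓ.trans hlog
    have hn' : (0 : ℝ) < n := by exact_mod_cast pos_of_one_le_log hlog1
    refine ⟨summable_abs_of_mem_sobolev hβ₀ hθ₀.2, ?_⟩
    have hrad : c * Real.sqrt (kOpt φ (x n) θ₀ / n) ≤
        credRadius φ (x n) (post n y) (θhat n y) α := by
      -- Nonemptiness matters: the infimum of the empty set is `0` by default, and the lower bound
      -- on the radius would fail.
      refine le_csInf ?_ fun r hr => ?_
      · refine ⟨Real.sqrt (C₂ * (kOpt φ (x n) θ₀ * Real.log n / n)) +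
          M * epsRate φ (x n) θ₀ (kOpt φ (x n) θ₀), ?_⟩
        rw [Set.mem_ofPred_eq, hp]
        exact hT.le_hierPosterior_ball hg hα.1.le
          ((hfar φ n (x n) y θ₀ (K n) ρ hlog hGr hk1 hT).trans (ENNReal.ofReal_le_ofReal hs1.le))
          hd
      · by_contra hlt
        rw [Set.mem_ofPred_eq, hp] at hr
        have h1 := hr.trans ((hierPosterior_mono φ g ρ (x n) y fun θ hθ =>
          le_trans hθ (not_le.1 hlt).le).trans (hball φ n (x n) y θ₀ (K n) ρ δ hlog1 hGr hk1
            (hM₀ n (x n) (hx n) θ₀ hθ₀.2) hθ₀.1 hT (θhat n y)))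
        have h2 : 0 ≤ Real.exp (-Real.log n) := (Real.exp_pos _).le
        rw [ENNReal.ofReal_le_ofReal_iff (by linarith [hα.2])] at h1
        linarith
    have e : M * (Real.sqrt 2 * Real.sqrt (kOpt φ (x n) θ₀ * Real.log n / n)) =
        M * Real.sqrt 2 / c * Real.sqrt (Real.log n) *
          (c * Real.sqrt (kOpt φ (x n) θ₀ / n)) := by
      rw [mul_div_right_comm, Real.sqrt_mul (by positivity)]
      field_simp
    calc empDist φ (x n) θ₀ (θhat n y)
        ≤ M * epsRate φ (x n) θ₀ (kOpt φ (x n) θ₀) := hd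
      _ ≤ M * (Real.sqrt 2 * Real.sqrt (kOpt φ (x n) θ₀ * Real.log n / n)) := by
          gcongr
          exact epsRate_le hb
      _ ≤ _ := by
          rw [e]
          gcongr
  · intro hcen ε hε
    obtain ⟨M, hM, hcenM⟩ := hcen (ε / 2) (by positivity)
    -- The factor `2` bounds the diameter by two radii; `√C₂` comes from contraction, `M √2` from
    -- the centre and `√Ck` from the oracle dimension.
    refine ⟨2 * (Real.sqrt C₂ + M * Real.sqrt 2) * Real.sqrt Ck, by positivity,
      le_liminf_of_le (by isBoundedDefault) ?_⟩
    filter_upwards [hcenM, htyp (ε / 2) (by positivity), hkOpt 1, hGram, eventually_ge_log ℓ,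
      tendsto_exp_neg_log.eventually_lt_const hα.1]
      with n hF hG hk hGr hlog hs1
    refine le_iInf₂ fun β hβ => le_iInf₂ fun θ₀ hθβ => ?_
    -- Centring and typicality are needed only on the largest class, `β = β₀`; the smoothness `β`
    -- enters only through the bound on `κ`.
    have hθ₀ := sobolev_subset hβ hθβ
    refine one_sub_le_measure_of_inter _ hε (hF θ₀ hθ₀)
      (G := {y | ∃ ρ, TypicalData φ g (x n) y θ₀ (K n) ρ C ∧
        ∀ B, post n y B = hierPosterior φ g ρ (x n) y B}) (hG θ₀ hθ₀) ?_
    rintro y ⟨hd, ρ, hT, hp⟩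
    obtain ⟨hk1, hb, hkle, -⟩ := hk β hβ θ₀ hθβ
    have hlog1 : 1 ≤ Real.log n := hℓ.trans hlog
    have hn' : (0 : ℝ) < n := by exact_mod_cast pos_of_one_le_log hlog1
    have hβ' : 1 / 2 < β := hβ₀.trans_le hβ
    set κ := kOpt φ (x n) θ₀ with hκ
    set a := (n : ℝ) / Real.log n with ha
    have ha0 : 0 < a := by positivity
    have hrate : Real.sqrt (κ * Real.log n / n) ≤ Real.sqrt Ck * a ^ (-(β / (1 + 2 * β))) := by
      have h1 : (κ : ℝ) * Real.log n / n ≤ Ck * (a ^ (-(β / (1 + 2 * β)))) ^ 2 := by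
        have e1 : (κ : ℝ) * Real.log n / n = κ / a := by
          rw [ha]
          field_simp
        rw [e1, div_le_iff₀ ha0, mul_assoc, ← Real.rpow_mul_natCast ha0.le,
          ← Real.rpow_add_one ha0.ne']
        refine hkle.trans_eq ?_
        congr 2
        push_cast
        field_simp
        ring
      refine (Real.sqrt_le_sqrt h1).trans_eq ?_
      rw [Real.sqrt_mul hCk.le, Real.sqrt_sq (by positivity)]
    have hrad : credRadius φ (x n) (post n y) (θhat n y) α ≤
        Real.sqrt (C₂ * (κ * Real.log n / n)) + M * epsRate φ (x n) θ₀ κ := by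
      refine csInf_le ⟨0, fun r hr => ?_⟩ ?_
      · rw [Set.mem_ofPred_eq, hp] at hr
        exact nonneg_of_le_hierPosterior_ball hα.2 hr
      · rw [Set.mem_ofPred_eq, hp]
        exact hT.le_hierPosterior_ball hg hα.1.le
          ((hfar φ n (x n) y θ₀ (K n) ρ hlog hGr hk1 hT).trans (ENNReal.ofReal_le_ofReal hs1.le))
          hd
    have hrad2 : credRadius φ (x n) (post n y) (θhat n y) α ≤
        (Real.sqrt C₂ + M * Real.sqrt 2) * (Real.sqrt Ck * a ^ (-(β / (1 + 2 * β)))) := by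
      refine hrad.trans ?_
      have h2 := mul_le_mul_of_nonneg_left (epsRate_le hb) hM.le
      rw [Real.sqrt_mul hC₂.le]
      calc Real.sqrt C₂ * Real.sqrt (κ * Real.log n / n) + M * epsRate φ (x n) θ₀ κ
          ≤ (Real.sqrt C₂ + M * Real.sqrt 2) * Real.sqrt (κ * Real.log n / n) := by linarith
        _ ≤ _ := by gcongr
    refine iSup₂_le fun θ hθ => iSup₂_le fun θ' hθ' => ENNReal.ofReal_le_ofReal ?_
    have h3 := empDist_triangle φ (x n) θ (θhat n y) θ'
    rw [empDist_comm φ (x n) (θhat n y) θ'] at h3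
    have h4 := hθ.2
    have h5 := hθ'.2
    rw [one_mul] at h4 h5
    linarith
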